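/- Consider the stochastic contextual bandit with linear payoffs. There are $N\ge 1$ arms and an unknown $\mu\in\mathbb R^d$. In each round $t=1,2,\dots$ context vectors $b_1(t),\dots,b_N(t)\in\mathbb R^d$ are revealed, chosen by an adversary that may adapt to the history $\mathcal H_{t-1}$ (the arms played, the rewards of the arms played, and all contexts in rounds $1,\dots,t-1$). The learner plays an arm $a(t)$ and observes its reward $r_{a(t)}(t)$. The rewards $r_i(t)$ satisfy $\mathbb E[r_i(t)\mid \mathcal H_{t-1},b_1(t),\dots,b_N(t)]=b_i(t)^T\mu$, and for a constant $R>0$ the noise $\eta_{i,t}=r_i(t)-b_i(t)^T\mu$ is conditionally $R$-sub-Gaussian: $\mathbb E[e^{\lambda\eta_{i,t}}\mid \mathcal H_{t-1},b_1(t),\dots,b_N(t)]\le e^{\lambda^2R^2/2}$ for all $\lambda\in\mathbb R$. Write $\Delta_i(t)=\max_j b_j(t)^T\mu-b_i(t)^T\mu$, assume $\|b_i(t)\|_2\le 1$, $\|\mu\|_2\le 1$ and $\Delta_i(t)\le 1$ for all $i,t$, and let $\mathcal R(T)=\sum_{t=1}^T\Delta_{a(t)}(t)$ be the total regret. Thompson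 Sampling with parameter $\delta\in(0,1)$ works as follows. In round $t$ put $B(t)=I_d+\sum_{\tau=1}^{t-1}b_{a(\tau)}(\tau)b_{a(\tau)}(\tau)^T$ and $\hat\mu(t)=B(t)^{-1}\sum_{\tau=1}^{t-1}b_{a(\tau)}(\tau)r_{a(\tau)}(\tau)$. Given $\mathcal H_{t-1}$ and the contexts of round $t$, draw $\tilde\mu(t)$ from $\mathcal N(\hat\mu(t),v_t^2B(t)^{-1})$ and play an arm $a(t)$ that maximizes $b_i(t)^T\tilde\mu(t)$ over $i$, ties being broken arbitrarily, where $\tilde\mu(t)$ and $a(t)$ are conditionally independent of the rewards $(r_i(t))_i$ of round $t$ given $\mathcal H_{t-1}$ and the contexts of round $t$. Here either $v_t=R\sqrt{9d\ln(t/\delta)}$ for all $t$ (horizon unknown), or $v_t=R\sqrt{9d\ln(T/\delta)}$ for all $t$ (horizon $T$ known). Then for every $R>0$ there is a constant $C$ depending only on $R$ such that for all $d$, $N\ge1$, $T\ge 2$, $0<\delta<1$, every such bandit problem and either choice of $v_t$, with probability at least $1-\delta$, $$\mathcal R(T)\le C\,\min\bigl\{d^{3/2}\sqrt T,\; d\sqrt{T\ln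 N}\bigr\}\left(\ln T+\sqrt{\ln T\,\ln(1/\delta)}\right).$$ -/

import Mathlib

open MeasureTheory ProbabilityTheory

noncomputable section

namespace LinBandit

/-- Context and parameter space `ℝ^d` with the Euclidean norm. -/
abbrev Vec (d : ℕ) : Type := EuclideanSpace ℝ (Fin d)

/-!
Throughout, rounds are `t = 1, 2, …` (index `0` is never used), arms are the elements of `Fin N`, and

* `b t i ω : Vec d` is the context of arm `i` in round `t`,
* `r t i ω : ℝ` is the reward of arm `i` in round `t`,
* `a t ω : Fin N` is the arm played in round `t`,
* `s t ω : Vec d` is the parameter vector sampled by the algorithm in round `t`.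
-/

section Processes

variable {Ω : Type*} {d N : ℕ}

/-- The gap `Δ_i(t)`: best mean reward in round `t` minus the mean reward of arm `i`. -/
def gap (μ : Vec d) (b : ℕ → Fin N → Ω → Vec d) (t : ℕ) (i : Fin N) (ω : Ω) : ℝ :=
  (⨆ j, inner ℝ (b t j ω) μ) - inner ℝ (b t i ω) μ

/-- The total regret `∑_{t=1}^T Δ_{a(t)}(t)`. -/
def regret (μ : Vec d) (b : ℕ → Fin N → Ω → Vec d) (a : ℕ → Ω → Fin N) (T : ℕ) (ω : Ω) : ℝ :=
  ∑ t ∈ Finset.Icc 1 T, gap μ b t (a t ω) ω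

/-- The σ-algebra of the history before round `t`: arms played, rewards of the arms played, and
all contexts, in rounds `1, …, t - 1`. -/
def history (b : ℕ → Fin N → Ω → Vec d) (r : ℕ → Fin N → Ω → ℝ) (a : ℕ → Ω → Fin N) (t : ℕ) :
    MeasurableSpace Ω :=
  ⨆ τ ∈ Finset.Ico 1 t,
    MeasurableSpace.comap (a τ) inferInstance ⊔
    MeasurableSpace.comap (fun ω => r τ (a τ ω) ω) inferInstance ⊔
    ⨆ i, MeasurableSpace.comap (b τ i) inferInstance

/-- The history before round `t` together with the contexts of round `t`. -/
def info (b : ℕ → Fin N → Ω → Vec d) (r : ℕ → Fin N → Ω → ℝ) (a : ℕ → Ω → Fin N) (t : ℕ) :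
    MeasurableSpace Ω :=
  history b r a t ⊔ ⨆ i, MeasurableSpace.comap (b t i) inferInstance

/-- `B(t) = I_d + ∑_{τ=1}^{t-1} b_{a(τ)}(τ) b_{a(τ)}(τ)ᵀ`. -/
def designMatrix (b : ℕ → Fin N → Ω → Vec d) (a : ℕ → Ω → Fin N) (t : ℕ) (ω : Ω) :
    Matrix (Fin d) (Fin d) ℝ :=
  1 + ∑ τ ∈ Finset.Ico 1 t,
    Matrix.vecMulVec (b τ (a τ ω) ω).ofLp (b τ (a τ ω) ω).ofLp

/-- `μ̂(t) = B(t)⁻¹ ∑_{τ=1}^{t-1} r_{a(τ)}(τ) b_{a(τ)}(τ)`. -/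
def estimate (b : ℕ → Fin N → Ω → Vec d) (r : ℕ → Fin N → Ω → ℝ) (a : ℕ → Ω → Fin N)
    (t : ℕ) (ω : Ω) : Vec d :=
  WithLp.toLp 2 (Matrix.mulVec (designMatrix b a t ω)⁻¹
    (∑ τ ∈ Finset.Ico 1 t, r τ (a τ ω) ω • (b τ (a τ ω) ω).ofLp))

/-- The stochastic contextual bandit with linear payoffs, parameter `μ` and conditionally
`R`-sub-Gaussian noise. The contexts are arbitrary random vectors, so they may be chosen by an
adaptive (and randomized) adversary. -/
structure IsLinearBandit [MeasurableSpace Ω] (P : Measure Ω) (R : ℝ) (μ : Vec d)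
    (b : ℕ → Fin N → Ω → Vec d) (r : ℕ → Fin N → Ω → ℝ) (a : ℕ → Ω → Fin N) : Prop where
  measurable_context : ∀ t, 1 ≤ t → ∀ i, Measurable (b t i)
  measurable_reward : ∀ t, 1 ≤ t → ∀ i, Measurable (r t i)
  measurable_arm : ∀ t, 1 ≤ t → Measurable (a t)
  norm_context_le : ∀ t, 1 ≤ t → ∀ i ω, ‖b t i ω‖ ≤ 1
  norm_param_le : ‖μ‖ ≤ 1
  gap_le : ∀ t, 1 ≤ t → ∀ i ω, gap μ b t i ω ≤ 1
  integrable_reward : ∀ t, 1 ≤ t → ∀ i, Integrable (r t i) P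
  /-- `E[r_i(t) | contexts of round t, history] = b_i(t)ᵀ μ`. -/
  mean_reward : ∀ t, 1 ≤ t → ∀ i,
    P[r t i | info b r a t] =ᵐ[P] fun ω => inner ℝ (b t i ω) μ
  integrable_exp_noise : ∀ t, 1 ≤ t → ∀ i, ∀ l : ℝ,
    Integrable (fun ω => Real.exp (l * (r t i ω - inner ℝ (b t i ω) μ))) P
  /-- `E[exp (l η_i(t)) | contexts of round t, history] ≤ exp (l² R² / 2)` for all real `l`. -/
  subGaussian_noise : ∀ t, 1 ≤ t → ∀ i, ∀ l : ℝ,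
    P[fun ω => Real.exp (l * (r t i ω - inner ℝ (b t i ω) μ)) | info b r a t]
      ≤ᵐ[P] fun _ => Real.exp (l ^ 2 * R ^ 2 / 2)

/-- The arms `a` are played by Thompson Sampling with scale parameters `v t`. -/
structure IsThompsonSampling [MeasurableSpace Ω] (P : Measure Ω) (v : ℕ → ℝ)
    (b : ℕ → Fin N → Ω → Vec d) (r : ℕ → Fin N → Ω → ℝ) (a : ℕ → Ω → Fin N)
    (s : ℕ → Ω → Vec d) : Prop where
  measurable_sample : ∀ t, 1 ≤ t → Measurable (s t)
  /-- Given the history and the contexts of round `t`, the sample has the Gaussian law with mean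
  `μ̂(t)` and covariance matrix `v_t² B(t)⁻¹`. -/
  sample_law : ∀ t, 1 ≤ t → ∀ A : Set (Vec d), MeasurableSet A →
    P⟦s t ⁻¹' A | info b r a t⟧ =ᵐ[P] fun ω =>
      (multivariateGaussian (estimate b r a t ω)
        ((v t) ^ 2 • (designMatrix b a t ω)⁻¹)).real A
  /-- The arm played maximizes `b_i(t)ᵀ s(t)`; ties may be broken arbitrarily. -/
  arm_argmax : ∀ t, 1 ≤ t → ∀ ω i, inner ℝ (b t i ω) (s t ω) ≤ inner ℝ (b t (a t ω) ω) (s t ω)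
  /-- The algorithm does not see the rewards of round `t` before it plays: its sample and its
  choice of arm (hence also its tie-breaking) are conditionally independent of the rewards of
  round `t`, given the history and the contexts of round `t`. -/
  choice_condIndep : ∀ t, 1 ≤ t → ∀ (A : Set (Vec d × Fin N)) (S : Set (Fin N → ℝ)),
    MeasurableSet A → MeasurableSet S →
    P⟦(fun ω => (s t ω, a t ω)) ⁻¹' A ∩ (fun ω i => r t i ω) ⁻¹' S | info b r a t⟧ =ᵐ[P]
      P⟦(fun ω => (s t ω, a t ω)) ⁻¹' A | info b r a t⟧ *
        P⟦(fun ω i => r t i ω) ⁻¹' S | info b r a t⟧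

end Processes

/-- `R √(9 d ln(x / δ))`: with `x = t` the scale of round `t` when the horizon is unknown, with
`x = T` the fixed scale for a known horizon `T`. -/
def scale (R : ℝ) (d : ℕ) (δ x : ℝ) : ℝ := R * √(9 * d * Real.log (x / δ))

/-- `d^{3/2} √T (ln T + √(ln T ln(1/δ)))`. -/
def dimBound (d T : ℕ) (δ : ℝ) : ℝ :=
  (d : ℝ) ^ (3 / 2 : ℝ) * √(T : ℝ) *
    (Real.log T + √(Real.log T * Real.log (1 / δ)))

/-- `d √(T ln N) (ln T + √(ln T ln(1/δ)))`. -/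
def armBound (d N T : ℕ) (δ : ℝ) : ℝ :=
  (d : ℝ) * √((T : ℝ) * Real.log N) *
    (Real.log T + √(Real.log T * Real.log (1 / δ)))

end LinBandit

end

/-!
With high probability the self-normalized noise is small, by a supermartingale that is a Gaussian
mixture of exponentials, so that `|b_i(t)ᵀ (μ̂(t) - μ)| ≤ κ v_t w_i(t)` for the width
`w_i(t) = √(b_i(t)ᵀ B(t)⁻¹ b_i(t))`. The sample deviates from `μ̂(t)` by `v_t w_i(t)` times a
standard Gaussian, and the maximum over the arms of the squares of these Gaussians is of order
`min d (log N)`. Call an arm unsaturated if its gap is at most `g w_i(t)`, where `g` is of order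
`v √(min d (log N))`. Unless the deviation is exceptionally large, the gap of the arm played is at
most `2 g` times the sum of its own width and the least width of an unsaturated arm.

The exceptional deviations are controlled by the exponential moment of the squared deviation, summed
over all rounds through a supermartingale; a union bound over the rounds would lose a factor
`√(log T)`. The sample does not belong to the history, so the supermartingale runs with the part of
the gap that exceeds `2 g`, which the next history determines.

By Gaussian anti-concentration the sample is optimistic with conditional probability at least `q`,
and an optimistic sample that is not exceptional plays an unsaturated arm. So the least squared
width of an unsaturated arm is at most `1 / q` times the conditional mean of the squared width of
the arm played, and another supermartingale turns this into a bound for the sums over the rounds.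
The elliptical potential lemma bounds the sum of the squared played widths by `2 d log (1 + T)`, and
the Cauchy–Schwarz inequality gives the regret bound.
-/

noncomputable section

namespace LinBandit

/-! ### Rank-one updates of positive definite matrices -/

section RankOne

open Matrix

variable {n : Type*}

lemma posSemidef_vecMulVec_self [Finite n] (u : n → ℝ) : (vecMulVec u u).PosSemidef := by
  simpa using posSemidef_vecMulVec_self_star u

variable [Fintype n]

lemma dotProduct_mulVec_comm_of_isHermitian {A : Matrix n n ℝ} (hA : A.IsHermitian)
    (x y : n → ℝ) : x ⬝ᵥ A *ᵥ y = y ⬝ᵥ A *ᵥ x := by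
  have hA' : Aᵀ = A := by simpa using hA.eq
  rw [dotProduct_mulVec, dotProduct_comm, ← mulVec_transpose, hA']

lemma sq_dotProduct_mulVec_le {A : Matrix n n ℝ} (hA : A.PosSemidef) (x y : n → ℝ) :
    (x ⬝ᵥ A *ᵥ y) ^ 2 ≤ (x ⬝ᵥ A *ᵥ x) * (y ⬝ᵥ A *ᵥ y) := by
  classical
  simpa only [toBilin'_apply'] using (toBilin' A).apply_sq_le_of_symm
    (fun z ↦ by simpa [toBilin'_apply'] using hA.dotProduct_mulVec_nonneg z)
    ⟨fun u w ↦ by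
      simpa [toBilin'_apply'] using dotProduct_mulVec_comm_of_isHermitian hA.isHermitian u w⟩ x y

lemma dotProduct_mulVec_self_nonneg {A : Matrix n n ℝ} (hA : A.PosSemidef) (x : n → ℝ) :
    0 ≤ x ⬝ᵥ A *ᵥ x := by
  simpa using hA.dotProduct_mulVec_nonneg x

lemma abs_dotProduct_mulVec_le {A : Matrix n n ℝ} (hA : A.PosSemidef) (x y : n → ℝ) :
    |x ⬝ᵥ A *ᵥ y| ≤ √(x ⬝ᵥ A *ᵥ x) * √(y ⬝ᵥ A *ᵥ y) := by
  rw [← Real.sqrt_mul (dotProduct_mulVec_self_nonneg hA x)]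
  exact Real.abs_le_sqrt (sq_dotProduct_mulVec_le hA x y)

lemma vecMulVec_mulVec_eq_smul {m : Type*} (u : m → ℝ) (w x : n → ℝ) :
    vecMulVec u w *ᵥ x = (w ⬝ᵥ x) • u := by
  rw [vecMulVec_mulVec, op_smul_eq_smul]

variable [DecidableEq n] {B : Matrix n n ℝ}

lemma isUnit_det_of_posDef (hB : B.PosDef) : IsUnit B.det :=
  (isUnit_iff_isUnit_det B).mp hB.isUnit

lemma det_add_vecMulVec_self (hB : B.PosDef) (u : n → ℝ) :
    (B + vecMulVec u u).det = B.det * (1 + u ⬝ᵥ B⁻¹ *ᵥ u) := by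
  rw [vecMulVec_eq Unit, det_add_replicateCol_mul_replicateRow (isUnit_det_of_posDef hB)]
  congr 1
  rw [det_unique, Matrix.mul_assoc, ← replicateCol_mulVec, Matrix.add_apply, one_apply_eq,
    replicateRow_mul_replicateCol_apply]

/- The Sherman–Morrison formula, applied to a vector. -/
lemma inv_add_vecMulVec_self_mulVec (hB : B.PosDef) (u y : n → ℝ) :
    (B + vecMulVec u u)⁻¹ *ᵥ y =
      B⁻¹ *ᵥ y - ((u ⬝ᵥ B⁻¹ *ᵥ y) / (1 + u ⬝ᵥ B⁻¹ *ᵥ u)) • (B⁻¹ *ᵥ u) := by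
  have hden : 0 ≤ u ⬝ᵥ B⁻¹ *ᵥ u := dotProduct_mulVec_self_nonneg hB.inv.posSemidef u
  have hsolve : (B + vecMulVec u u) *ᵥ
      (B⁻¹ *ᵥ y - ((u ⬝ᵥ B⁻¹ *ᵥ y) / (1 + u ⬝ᵥ B⁻¹ *ᵥ u)) • (B⁻¹ *ᵥ u)) = y := by
    rw [mulVec_sub, mulVec_smul, add_mulVec, add_mulVec, mulVec_mulVec _ B, mulVec_mulVec _ B,
      mul_nonsing_inv _ (isUnit_det_of_posDef hB), one_mulVec, one_mulVec,
      vecMulVec_mulVec_eq_smul, vecMulVec_mulVec_eq_smul]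
    ext i
    simp only [Pi.add_apply, Pi.sub_apply, Pi.smul_apply, smul_eq_mul]
    field_simp
    ring
  conv_lhs => rw [← hsolve]
  rw [mulVec_mulVec, nonsing_inv_mul _ (isUnit_det_of_posDef
    (hB.add_posSemidef (posSemidef_vecMulVec_self u))), one_mulVec]

lemma dotProduct_inv_add_vecMulVec_self_add_smul (hB : B.PosDef) (u y : n → ℝ) (e : ℝ) :
    (y + e • u) ⬝ᵥ (B + vecMulVec u u)⁻¹ *ᵥ (y + e • u) =
      y ⬝ᵥ B⁻¹ *ᵥ y + (2 * e * (u ⬝ᵥ B⁻¹ *ᵥ y) + e ^ 2 * (u ⬝ᵥ B⁻¹ *ᵥ u)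
        - (u ⬝ᵥ B⁻¹ *ᵥ y) ^ 2) / (1 + u ⬝ᵥ B⁻¹ *ᵥ u) := by
  have hden : 0 ≤ u ⬝ᵥ B⁻¹ *ᵥ u := dotProduct_mulVec_self_nonneg hB.inv.posSemidef u
  rw [inv_add_vecMulVec_self_mulVec hB]
  simp only [mulVec_add, mulVec_smul, dotProduct_add, dotProduct_sub, add_dotProduct,
    dotProduct_smul, smul_dotProduct, smul_eq_mul]
  rw [dotProduct_mulVec_comm_of_isHermitian hB.inv.isHermitian y u]
  field_simp
  ring

lemma det_le_pow_of_forall_dotProduct_le (hB : B.PosSemidef) {c : ℝ}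
    (h : ∀ x : n → ℝ, x ⬝ᵥ B *ᵥ x ≤ c * (x ⬝ᵥ x)) : B.det ≤ c ^ Fintype.card n := by
  rw [hB.isHermitian.det_eq_prod_eigenvalues, ← Finset.card_univ, ← Finset.prod_const]
  refine Finset.prod_le_prod (fun i _ ↦ hB.eigenvalues_nonneg i) fun i _ ↦ ?_
  have hunit : (hB.isHermitian.eigenvectorBasis i).ofLp ⬝ᵥ
      (hB.isHermitian.eigenvectorBasis i).ofLp = 1 := by
    have := hB.isHermitian.eigenvectorBasis.orthonormal.1 i
    rw [EuclideanSpace.norm_eq, Real.sqrt_eq_one] at this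
    simpa [dotProduct, sq] using this
  have := h (hB.isHermitian.eigenvectorBasis i).ofLp
  rw [hB.isHermitian.mulVec_eigenvectorBasis i] at this
  simpa [dotProduct_smul, hunit] using this

lemma dotProduct_inv_le_dotProduct_self (hB : B.PosDef)
    (h : ∀ x : n → ℝ, x ⬝ᵥ x ≤ x ⬝ᵥ B *ᵥ x) (y : n → ℝ) : y ⬝ᵥ B⁻¹ *ᵥ y ≤ y ⬝ᵥ y := by
  have hle := h (B⁻¹ *ᵥ y)
  rw [mulVec_mulVec, mul_nonsing_inv _ (isUnit_det_of_posDef hB), one_mulVec,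
    dotProduct_comm _ y] at hle
  have hsq : 0 ≤ (y - B⁻¹ *ᵥ y) ⬝ᵥ (y - B⁻¹ *ᵥ y) := by
    simpa using dotProduct_star_self_nonneg (y - B⁻¹ *ᵥ y)
  simp only [dotProduct_sub, sub_dotProduct] at hsq
  rw [dotProduct_comm (B⁻¹ *ᵥ y) y] at hsq
  linarith

end RankOne

/-! ### Regularized Gram matrices and ridge regression -/

section RegGram

open Matrix

variable {n : Type*} [DecidableEq n]

/-- The regularized Gram matrix `1 + ∑_{τ=1}^{t-1} u_τ u_τᵀ` of a sequence of vectors: the matrix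
`designMatrix` for an arbitrary sequence in place of the contexts played. -/
def regGram (u : ℕ → n → ℝ) (t : ℕ) : Matrix n n ℝ :=
  1 + ∑ τ ∈ Finset.Ico 1 t, vecMulVec (u τ) (u τ)

variable {u : ℕ → n → ℝ}

lemma regGram_one : regGram u 1 = 1 := by
  simp [regGram]

lemma regGram_succ {t : ℕ} (ht : 1 ≤ t) :
    regGram u (t + 1) = regGram u t + vecMulVec (u t) (u t) := by
  simp only [regGram, Finset.sum_Ico_succ_top ht, add_assoc]

lemma posDef_regGram [Finite n] (t : ℕ) : (regGram u t).PosDef :=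
  PosDef.one.add_posSemidef (posSemidef_sum _ fun τ _ ↦ posSemidef_vecMulVec_self (u τ))

variable [Fintype n]

lemma dotProduct_inv_regGram_nonneg (t : ℕ) (x : n → ℝ) : 0 ≤ x ⬝ᵥ (regGram u t)⁻¹ *ᵥ x :=
  dotProduct_mulVec_self_nonneg (posDef_regGram t).inv.posSemidef x

lemma regGram_mulVec (t : ℕ) (x : n → ℝ) :
    regGram u t *ᵥ x = x + ∑ τ ∈ Finset.Ico 1 t, (u τ ⬝ᵥ x) • u τ := by
  simp only [regGram, add_mulVec, one_mulVec, sum_mulVec, vecMulVec_mulVec_eq_smul]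

lemma dotProduct_regGram (t : ℕ) (x : n → ℝ) :
    x ⬝ᵥ regGram u t *ᵥ x = x ⬝ᵥ x + ∑ τ ∈ Finset.Ico 1 t, (u τ ⬝ᵥ x) ^ 2 := by
  simp only [regGram_mulVec, dotProduct_add, dotProduct_sum, dotProduct_smul, smul_eq_mul, sq,
    dotProduct_comm x (u _)]

lemma dotProduct_inv_regGram_le (t : ℕ) (x : n → ℝ) : x ⬝ᵥ (regGram u t)⁻¹ *ᵥ x ≤ x ⬝ᵥ x := by
  refine dotProduct_inv_le_dotProduct_self (posDef_regGram t) (fun z ↦ ?_) x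
  rw [dotProduct_regGram]
  exact le_add_of_nonneg_right (Finset.sum_nonneg fun _ _ ↦ sq_nonneg _)

lemma dotProduct_regGram_le (hu : ∀ τ, 1 ≤ τ → u τ ⬝ᵥ u τ ≤ 1) {t : ℕ} (ht : 1 ≤ t) (x : n → ℝ) :
    x ⬝ᵥ regGram u t *ᵥ x ≤ t * (x ⬝ᵥ x) := by
  have hx : 0 ≤ x ⬝ᵥ x := by simpa using dotProduct_star_self_nonneg x
  have hterm : ∀ τ ∈ Finset.Ico 1 t, (u τ ⬝ᵥ x) ^ 2 ≤ x ⬝ᵥ x := fun τ hτ ↦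
    calc (u τ ⬝ᵥ x) ^ 2 ≤ (u τ ⬝ᵥ u τ) * (x ⬝ᵥ x) := by
          simpa using sq_dotProduct_mulVec_le PosSemidef.one (u τ) x
      _ ≤ x ⬝ᵥ x := mul_le_of_le_one_left hx (hu τ (Finset.mem_Ico.mp hτ).1)
  have hsum := Finset.sum_le_card_nsmul _ _ _ hterm
  rw [Nat.card_Ico, nsmul_eq_mul, Nat.cast_sub ht, Nat.cast_one] at hsum
  rw [dotProduct_regGram]
  linarith

lemma one_le_det_regGram {t : ℕ} (ht : 1 ≤ t) : 1 ≤ (regGram u t).det := by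
  induction t, ht using Nat.le_induction with
  | base => simp [regGram_one]
  | succ t ht ih =>
    rw [regGram_succ ht, det_add_vecMulVec_self (posDef_regGram t)]
    nlinarith [dotProduct_inv_regGram_nonneg (u := u) t (u t)]

lemma log_det_regGram_le (hu : ∀ τ, 1 ≤ τ → u τ ⬝ᵥ u τ ≤ 1) {t : ℕ} (ht : 1 ≤ t) :
    Real.log (regGram u t).det ≤ Fintype.card n * Real.log t := by
  rw [← Real.log_pow]
  exact Real.log_le_log (zero_lt_one.trans_le (one_le_det_regGram ht))
    (det_le_pow_of_forall_dotProduct_le (posDef_regGram t).posSemidef (dotProduct_regGram_le hu ht))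

lemma le_two_mul_log_one_add {w : ℝ} (h0 : 0 ≤ w) (h1 : w ≤ 1) : w ≤ 2 * Real.log (1 + w) := by
  have hpos : 0 < 1 + w := by linarith
  calc w ≤ 2 * (w / (1 + w)) := by
        rw [mul_div_assoc', le_div_iff₀ hpos]
        nlinarith
    _ = 2 * (1 - (1 + w)⁻¹) := by field_simp; ring
    _ ≤ 2 * Real.log (1 + w) := by gcongr; exact Real.one_sub_inv_le_log_of_pos hpos

/- The elliptical potential lemma: each term is at most twice the increment of the logarithm of the
determinant. -/
lemma sum_dotProduct_inv_regGram_le (hu : ∀ τ, 1 ≤ τ → u τ ⬝ᵥ u τ ≤ 1) (T : ℕ) :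
    ∑ t ∈ Finset.Icc 1 T, u t ⬝ᵥ (regGram u t)⁻¹ *ᵥ u t ≤
      2 * Real.log (regGram u (T + 1)).det := by
  induction T with
  | zero => simp [regGram_one]
  | succ T ih =>
    have hnonneg := dotProduct_inv_regGram_nonneg (u := u) (T + 1) (u (T + 1))
    have hle_one := (dotProduct_inv_regGram_le (u := u) (T + 1) (u (T + 1))).trans
      (hu (T + 1) (by omega))
    rw [Finset.sum_Icc_succ_top (by omega), regGram_succ (t := T + 1) (by omega),
      det_add_vecMulVec_self (posDef_regGram _),
      Real.log_mul (zero_lt_one.trans_le (one_le_det_regGram (by omega))).ne' (by positivity)]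
    linarith [le_two_mul_log_one_add hnonneg hle_one]

lemma inv_regGram_mulVec_sum_sub (t : ℕ) (y : ℕ → ℝ) (x : n → ℝ) :
    (regGram u t)⁻¹ *ᵥ (∑ τ ∈ Finset.Ico 1 t, y τ • u τ) - x =
      (regGram u t)⁻¹ *ᵥ (∑ τ ∈ Finset.Ico 1 t, (y τ - u τ ⬝ᵥ x) • u τ - x) := by
  have hsum : ∑ τ ∈ Finset.Ico 1 t, y τ • u τ =
      ∑ τ ∈ Finset.Ico 1 t, (y τ - u τ ⬝ᵥ x) • u τ - x + regGram u t *ᵥ x := by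
    rw [regGram_mulVec]
    simp only [sub_smul, Finset.sum_sub_distrib]
    abel
  rw [hsum, mulVec_add, mulVec_mulVec,
    nonsing_inv_mul _ (isUnit_det_of_posDef (posDef_regGram t)), one_mulVec, add_sub_cancel_right]

end RegGram

/-! ### The regularized least-squares estimate of the bandit -/

section Design

open Matrix

variable {Ω : Type*} {d N : ℕ}

/-- The context `b_{a(t)}(t)` of the arm played in round `t`, as a coordinate vector. -/
def playedContext (b : ℕ → Fin N → Ω → Vec d) (a : ℕ → Ω → Fin N) (ω : Ω) (t : ℕ) : Fin d → ℝ :=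
  (b t (a t ω) ω).ofLp

/-- The noise `η_{a(t),t}` of the reward observed in round `t`. -/
def playedNoise (μ : Vec d) (b : ℕ → Fin N → Ω → Vec d) (r : ℕ → Fin N → Ω → ℝ)
    (a : ℕ → Ω → Fin N) (ω : Ω) (t : ℕ) : ℝ :=
  r t (a t ω) ω - inner ℝ (b t (a t ω) ω) μ

/-- The width `√(b_i(t)ᵀ B(t)⁻¹ b_i(t))` of the confidence interval of arm `i` in round `t`. -/
def width (b : ℕ → Fin N → Ω → Vec d) (a : ℕ → Ω → Fin N) (t : ℕ) (i : Fin N) (ω : Ω) : ℝ :=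
  √((b t i ω).ofLp ⬝ᵥ (designMatrix b a t ω)⁻¹ *ᵥ (b t i ω).ofLp)

/-- The sum of the contexts played before round `t`, weighted by the noise of their rewards. -/
def noiseSum (μ : Vec d) (b : ℕ → Fin N → Ω → Vec d) (r : ℕ → Fin N → Ω → ℝ) (a : ℕ → Ω → Fin N)
    (t : ℕ) (ω : Ω) : Fin d → ℝ :=
  ∑ τ ∈ Finset.Ico 1 t, playedNoise μ b r a ω τ • playedContext b a ω τ

/-- The self-normalized noise: the squared norm of `noiseSum` with respect to the inverse of the
design matrix, which controls the error of the estimate. -/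
def selfNormSq (μ : Vec d) (b : ℕ → Fin N → Ω → Vec d) (r : ℕ → Fin N → Ω → ℝ)
    (a : ℕ → Ω → Fin N) (t : ℕ) (ω : Ω) : ℝ :=
  noiseSum μ b r a t ω ⬝ᵥ (designMatrix b a t ω)⁻¹ *ᵥ noiseSum μ b r a t ω

/-- The inner product of `noiseSum` with the context of arm `i` in round `t`, with respect to the
inverse of the design matrix. -/
def noiseDrift (μ : Vec d) (b : ℕ → Fin N → Ω → Vec d) (r : ℕ → Fin N → Ω → ℝ)
    (a : ℕ → Ω → Fin N) (t : ℕ) (i : Fin N) (ω : Ω) : ℝ :=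
  (b t i ω).ofLp ⬝ᵥ (designMatrix b a t ω)⁻¹ *ᵥ noiseSum μ b r a t ω

variable {μ : Vec d} {b : ℕ → Fin N → Ω → Vec d} {r : ℕ → Fin N → Ω → ℝ} {a : ℕ → Ω → Fin N}

lemma dotProduct_ofLp_eq_inner (x y : Vec d) : x.ofLp ⬝ᵥ y.ofLp = inner ℝ x y := by
  simp [PiLp.inner_apply, dotProduct, mul_comm]

lemma dotProduct_ofLp_self_le_one {x : Vec d} (hx : ‖x‖ ≤ 1) : x.ofLp ⬝ᵥ x.ofLp ≤ 1 := by
  rw [dotProduct_ofLp_eq_inner, real_inner_self_eq_norm_sq]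
  exact pow_le_one₀ (norm_nonneg x) hx

lemma designMatrix_eq_regGram (t : ℕ) (ω : Ω) :
    designMatrix b a t ω = regGram (playedContext b a ω) t := rfl

lemma posDef_designMatrix (t : ℕ) (ω : Ω) : (designMatrix b a t ω).PosDef :=
  posDef_regGram t

lemma dotProduct_playedContext_le_one (hb : ∀ t, 1 ≤ t → ∀ i ω, ‖b t i ω‖ ≤ 1) (ω : Ω) (t : ℕ)
    (ht : 1 ≤ t) : playedContext b a ω t ⬝ᵥ playedContext b a ω t ≤ 1 :=
  dotProduct_ofLp_self_le_one (hb t ht (a t ω) ω)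

lemma log_det_designMatrix_le (hb : ∀ t, 1 ≤ t → ∀ i ω, ‖b t i ω‖ ≤ 1) {t : ℕ} (ht : 1 ≤ t)
    (ω : Ω) : Real.log (designMatrix b a t ω).det ≤ d * Real.log t := by
  simpa [designMatrix_eq_regGram] using
    log_det_regGram_le (dotProduct_playedContext_le_one (a := a) hb ω) ht

lemma width_nonneg (t : ℕ) (i : Fin N) (ω : Ω) : 0 ≤ width b a t i ω := Real.sqrt_nonneg _

lemma sq_width (t : ℕ) (i : Fin N) (ω : Ω) :
    width b a t i ω ^ 2 = (b t i ω).ofLp ⬝ᵥ (designMatrix b a t ω)⁻¹ *ᵥ (b t i ω).ofLp :=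
  Real.sq_sqrt (dotProduct_inv_regGram_nonneg t _)

lemma sum_sq_width_le (hb : ∀ t, 1 ≤ t → ∀ i ω, ‖b t i ω‖ ≤ 1) (T : ℕ) (ω : Ω) :
    ∑ t ∈ Finset.Icc 1 T, width b a t (a t ω) ω ^ 2 ≤ 2 * (d * Real.log (T + 1)) := by
  simp only [sq_width]
  calc _ ≤ 2 * Real.log (designMatrix b a (T + 1) ω).det :=
        sum_dotProduct_inv_regGram_le (dotProduct_playedContext_le_one hb ω) T
    _ ≤ _ := by simpa using log_det_designMatrix_le (a := a) hb (Nat.succ_le_succ T.zero_le) ω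

lemma estimate_sub (t : ℕ) (ω : Ω) :
    (estimate b r a t ω - μ).ofLp =
      (designMatrix b a t ω)⁻¹ *ᵥ (noiseSum μ b r a t ω - μ.ofLp) := by
  refine (inv_regGram_mulVec_sum_sub (u := playedContext b a ω) t (fun τ ↦ r τ (a τ ω) ω)
    μ.ofLp).trans ?_
  simp only [playedContext, dotProduct_ofLp_eq_inner]
  rfl

lemma abs_inner_estimate_sub_le (hμ : ‖μ‖ ≤ 1) (t : ℕ) (i : Fin N) (ω : Ω) :
    |inner ℝ (b t i ω) (estimate b r a t ω) - inner ℝ (b t i ω) μ| ≤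
      width b a t i ω * (√(selfNormSq μ b r a t ω) + 1) := by
  have hB := (posDef_designMatrix (b := b) (a := a) t ω).inv.posSemidef
  have hμB : √(μ.ofLp ⬝ᵥ (designMatrix b a t ω)⁻¹ *ᵥ μ.ofLp) ≤ 1 :=
    Real.sqrt_le_one.mpr ((dotProduct_inv_regGram_le t _).trans (dotProduct_ofLp_self_le_one hμ))
  rw [← inner_sub_right, ← dotProduct_ofLp_eq_inner, estimate_sub (μ := μ), mulVec_sub,
    dotProduct_sub, mul_add]
  exact (abs_sub _ _).trans (add_le_add (abs_dotProduct_mulVec_le hB _ _)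
    ((abs_dotProduct_mulVec_le hB _ _).trans
      (mul_le_mul_of_nonneg_left hμB (Real.sqrt_nonneg _))))

lemma selfNormSq_one (ω : Ω) : selfNormSq μ b r a 1 ω = 0 := by
  simp [selfNormSq, noiseSum]

lemma selfNormSq_succ {t : ℕ} (ht : 1 ≤ t) (ω : Ω) :
    selfNormSq μ b r a (t + 1) ω = selfNormSq μ b r a t ω +
      (2 * playedNoise μ b r a ω t * noiseDrift μ b r a t (a t ω) ω +
        playedNoise μ b r a ω t ^ 2 * width b a t (a t ω) ω ^ 2 -
        noiseDrift μ b r a t (a t ω) ω ^ 2) / (1 + width b a t (a t ω) ω ^ 2) := by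
  rw [selfNormSq, noiseSum, Finset.sum_Ico_succ_top ht, designMatrix_eq_regGram, regGram_succ ht,
    dotProduct_inv_add_vecMulVec_self_add_smul (posDef_regGram t), sq_width]
  rfl

lemma det_designMatrix_succ {t : ℕ} (ht : 1 ≤ t) (ω : Ω) :
    (designMatrix b a (t + 1) ω).det =
      (designMatrix b a t ω).det * (1 + width b a t (a t ω) ω ^ 2) := by
  rw [designMatrix_eq_regGram, regGram_succ ht, det_add_vecMulVec_self (posDef_regGram t), sq_width]
  rfl

end Design

/-! ### Conditional means -/

section CondMean

open scoped ENNReal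

variable {Ω : Type*} {m m' mΩ : MeasurableSpace Ω} {P : Measure Ω} {f : Ω → ℝ≥0∞}

/-- The conditional mean of `f` given `m` is at most one. The integrated form needs neither
integrability of `f` nor a finite measure, and passes to restrictions of the measure. -/
def CondMeanLEOne (P : Measure Ω) (m : MeasurableSpace Ω) (f : Ω → ℝ≥0∞) : Prop :=
  ∀ ψ : Ω → ℝ≥0∞, Measurable[m] ψ → ∫⁻ ω, ψ ω * f ω ∂P ≤ ∫⁻ ω, ψ ω ∂P

lemma setLIntegral_ofReal_eq_ofReal_setIntegral {g : Ω → ℝ} (hg : Integrable g P)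
    (hg0 : 0 ≤ᵐ[P] g) (A : Set Ω) :
    ∫⁻ ω in A, ENNReal.ofReal (g ω) ∂P = ENNReal.ofReal (∫ ω in A, g ω ∂P) :=
  (ofReal_integral_eq_lintegral_ofReal hg.integrableOn (ae_restrict_of_ae hg0)).symm

lemma CondMeanLEOne.of_condExp_le_one [IsFiniteMeasure P] (hm : m ≤ mΩ) {g : Ω → ℝ}
    (hg : Integrable g P) (hg0 : 0 ≤ᵐ[P] g) (hg1 : P[g | m] ≤ᵐ[P] 1) :
    CondMeanLEOne P m fun ω ↦ ENNReal.ofReal (g ω) := by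
  have htrim : (P.withDensity fun ω ↦ ENNReal.ofReal (g ω)).trim hm ≤ P.trim hm := by
    refine Measure.le_iff.mpr fun A hA ↦ ?_
    rw [trim_measurableSet_eq hm hA, trim_measurableSet_eq hm hA, withDensity_apply _ (hm _ hA),
      setLIntegral_ofReal_eq_ofReal_setIntegral hg hg0, ← setIntegral_condExp hm hg hA,
      ← ofReal_measureReal]
    refine ENNReal.ofReal_le_ofReal ((setIntegral_mono_ae integrable_condExp.integrableOn
      (integrable_const 1).integrableOn hg1).trans_eq ?_)
    simp
  intro ψ hψ
  calc ∫⁻ ω, ψ ω * ENNReal.ofReal (g ω) ∂P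
      = ∫⁻ ω, ψ ω ∂(P.withDensity fun ω ↦ ENNReal.ofReal (g ω)) := by
        rw [lintegral_withDensity_eq_lintegral_mul₀ hg.aemeasurable.ennreal_ofReal
          (hψ.mono hm le_rfl).aemeasurable]
        simp only [Pi.mul_apply, mul_comm]
    _ ≤ ∫⁻ ω, ψ ω ∂P := by
        rw [← lintegral_trim hm hψ, ← lintegral_trim hm hψ]
        exact lintegral_mono' htrim le_rfl

lemma CondMeanLEOne.mono {g : Ω → ℝ≥0∞} (hf : CondMeanLEOne P m f) (hgf : g ≤ f) :
    CondMeanLEOne P m g :=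
  fun ψ hψ ↦ (lintegral_mono fun ω ↦ mul_le_mul_right (hgf ω) _).trans (hf ψ hψ)

lemma CondMeanLEOne.restrict_measurableSet (hm : m ≤ mΩ) (hf : CondMeanLEOne P m f) {A : Set Ω}
    (hA : MeasurableSet[m] A) : CondMeanLEOne (P.restrict A) m f := by
  intro ψ hψ
  rw [← lintegral_indicator (hm A hA), ← lintegral_indicator (hm A hA)]
  simpa only [Set.indicator_mul_left] using hf _ (hψ.indicator hA)

lemma lintegral_eq_tsum_setLIntegral_fiber {ι : Type*} [Countable ι] {k : Ω → ι}
    (hk : ∀ i, MeasurableSet (k ⁻¹' {i})) (f : Ω → ℝ≥0∞) :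
    ∫⁻ ω, f ω ∂P = ∑' i, ∫⁻ ω in k ⁻¹' {i}, f ω ∂P := by
  rw [← lintegral_iUnion hk fun i j hij ↦ Disjoint.preimage _ (by simpa using hij),
    ← Set.preimage_iUnion, Set.iUnion_of_singleton, Set.preimage_univ, setLIntegral_univ]

lemma CondMeanLEOne.of_countable_partition {ι : Type*} [Countable ι] {k : Ω → ι}
    {f : ι → Ω → ℝ≥0∞} (hk : ∀ i, MeasurableSet (k ⁻¹' {i}))
    (hf : ∀ i, CondMeanLEOne (P.restrict (k ⁻¹' {i})) m (f i)) :
    CondMeanLEOne P m fun ω ↦ f (k ω) ω := by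
  intro ψ hψ
  rw [lintegral_eq_tsum_setLIntegral_fiber hk, lintegral_eq_tsum_setLIntegral_fiber hk ψ]
  refine ENNReal.tsum_le_tsum fun i ↦ (le_of_eq ?_).trans (hf i ψ hψ)
  exact setLIntegral_congr_fun (hk i) fun ω (hω : k ω = i) ↦ by simp only [hω]

lemma CondMeanLEOne.lintegral {α : Type*} [MeasurableSpace α] {ρ : Measure α}
    [IsProbabilityMeasure ρ] [SFinite P] (hm : m ≤ mΩ) {F : α → Ω → ℝ≥0∞}
    (hF : Measurable (Function.uncurry F)) (h : ∀ z, CondMeanLEOne P m (F z)) :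
    CondMeanLEOne P m fun ω ↦ ∫⁻ z, F z ω ∂ρ := by
  intro ψ hψ
  have hψ' : Measurable ψ := hψ.mono hm le_rfl
  calc ∫⁻ ω, ψ ω * ∫⁻ z, F z ω ∂ρ ∂P = ∫⁻ ω, ∫⁻ z, ψ ω * F z ω ∂ρ ∂P :=
        lintegral_congr fun ω ↦ (lintegral_const_mul _ (hF.comp measurable_prodMk_right)).symm
    _ = ∫⁻ z, ∫⁻ ω, ψ ω * F z ω ∂P ∂ρ :=
        lintegral_lintegral_swap ((hψ'.comp measurable_fst).mul
          (hF.comp measurable_swap)).aemeasurable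
    _ ≤ ∫⁻ _z, ∫⁻ ω, ψ ω ∂P ∂ρ := lintegral_mono fun z ↦ h z ψ hψ
    _ = ∫⁻ ω, ψ ω ∂P := by simp

-- Simple functions split the space into finitely many events of `m`; Fatou does the rest.
lemma CondMeanLEOne.comp_stronglyMeasurable {E : Type*} [TopologicalSpace E] [MeasurableSpace E]
    (hm : m ≤ mΩ) {F : E → Ω → ℝ≥0∞} (hF : Measurable (Function.uncurry F))
    (hcont : ∀ ω, Continuous fun l ↦ F l ω) (h : ∀ l, CondMeanLEOne P m (F l)) {l : Ω → E}
    (hl : StronglyMeasurable[m] l) : CondMeanLEOne P m fun ω ↦ F (l ω) ω := by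
  let l' := hl.approx
  have hsimple (n : ℕ) : CondMeanLEOne P m fun ω ↦ F (l' n ω) ω := by
    have := (@SimpleFunc.finite_range _ _ m (l' n)).to_subtype
    have hfiber (i : Set.range (l' n)) :
        MeasurableSet[m] (Set.rangeFactorization (l' n) ⁻¹' {i}) := by
      convert @SimpleFunc.measurableSet_fiber _ _ m (l' n) i.1
      exact Set.ext fun ω ↦ Subtype.ext_iff
    exact CondMeanLEOne.of_countable_partition (f := fun i : Set.range (l' n) ↦ F i)
      (fun i ↦ hm _ (hfiber i)) fun i ↦ (h i).restrict_measurableSet hm (hfiber i)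
  intro ψ hψ
  have hmeas (n : ℕ) : Measurable fun ω ↦ ψ ω * F (l' n ω) ω :=
    (hψ.mono hm le_rfl).mul (hF.comp (((@SimpleFunc.measurable _ _ m _ (l' n)).mono hm
      le_rfl).prodMk measurable_id))
  calc ∫⁻ ω, ψ ω * F (l ω) ω ∂P
      ≤ ∫⁻ ω, Filter.liminf (fun n ↦ ψ ω * F (l' n ω) ω) Filter.atTop ∂P := by
        refine lintegral_mono fun ω ↦ ?_
        rcases eq_or_ne (F (l ω) ω) 0 with h0 | h0
        · simp [h0]
        · exact (ENNReal.Tendsto.const_mul (((hcont ω).tendsto _).comp (hl.tendsto_approx ω))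
            (Or.inl h0)).liminf_eq.ge
    _ ≤ Filter.liminf (fun n ↦ ∫⁻ ω, ψ ω * F (l' n ω) ω ∂P) Filter.atTop :=
        lintegral_liminf_le hmeas
    _ ≤ ∫⁻ ω, ψ ω ∂P := Filter.liminf_le_of_le (by isBoundedDefault) fun c hc ↦
        hc.exists.elim fun n hn ↦ hn.trans (hsimple n ψ hψ)

lemma measure_inter_inter_eq_setLIntegral_condExp [IsFiniteMeasure P] (hm : m ≤ mΩ)
    {D S A : Set Ω} (hD : MeasurableSet D) (hS : MeasurableSet S)
    (hind : P⟦D ∩ S | m⟧ =ᵐ[P] P⟦D | m⟧ * P⟦S | m⟧) (hA : MeasurableSet[m] A) :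
    P (D ∩ S ∩ A) = ∫⁻ ω in S ∩ A, ENNReal.ofReal ((P⟦D | m⟧) ω) ∂P := by
  have hprod : P⟦D | m⟧ * S.indicator (fun _ ↦ (1 : ℝ)) = S.indicator (P⟦D | m⟧) := by
    ext ω
    by_cases hω : ω ∈ S <;> simp [hω]
  have hprod_int : Integrable (P⟦D | m⟧ * S.indicator fun _ ↦ (1 : ℝ)) P :=
    hprod ▸ integrable_condExp.indicator hS
  have hcond : P⟦D ∩ S | m⟧ =ᵐ[P] P[S.indicator (P⟦D | m⟧) | m] := by
    rw [← hprod]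
    exact hind.trans (condExp_mul_of_stronglyMeasurable_left stronglyMeasurable_condExp hprod_int
      ((integrable_const _).indicator hS)).symm
  have hnonneg : 0 ≤ᵐ[P] P⟦D | m⟧ :=
    condExp_nonneg (ae_of_all _ fun _ ↦ Set.indicator_nonneg (fun _ _ ↦ zero_le_one) _)
  rw [setLIntegral_ofReal_eq_ofReal_setIntegral integrable_condExp hnonneg, Set.inter_comm S A,
    ← setIntegral_indicator hS, ← setIntegral_condExp hm (integrable_condExp.indicator hS) hA,
    ← setIntegral_congr_ae (hm _ hA) (hcond.mono fun _ h _ ↦ h),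
    setIntegral_condExp hm ((integrable_const _).indicator (hD.inter hS)) hA,
    setIntegral_indicator (hD.inter hS), setIntegral_const, smul_eq_mul, mul_one,
    ofReal_measureReal, Set.inter_comm A]

lemma generateFrom_image2_inter_eq_sup (m m' : MeasurableSpace Ω) :
    MeasurableSpace.generateFrom
      (Set.image2 (· ∩ ·) {S | MeasurableSet[m'] S} {A | MeasurableSet[m] A}) = m ⊔ m' := by
  refine le_antisymm (MeasurableSpace.generateFrom_le ?_) (sup_le (fun A hA ↦ ?_) fun S hS ↦ ?_)
  · rintro _ ⟨S, hS, A, hA, rfl⟩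
    exact MeasurableSet.inter (le_sup_right (a := m) S hS) (le_sup_left (b := m') A hA)
  · exact MeasurableSpace.measurableSet_generateFrom ⟨_, .univ, A, hA, Set.univ_inter A⟩
  · exact MeasurableSpace.measurableSet_generateFrom ⟨S, hS, _, .univ, Set.inter_univ S⟩

lemma isPiSystem_image2_inter (m m' : MeasurableSpace Ω) :
    IsPiSystem (Set.image2 (· ∩ ·) {S | MeasurableSet[m'] S} {A | MeasurableSet[m] A}) := by
  rintro _ ⟨S, hS, A, hA, rfl⟩ _ ⟨S', hS', A', hA', rfl⟩ -
  exact ⟨S ∩ S', MeasurableSet.inter hS hS', A ∩ A', MeasurableSet.inter hA hA',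
    Set.inter_inter_inter_comm S S' A A'⟩

lemma setLIntegral_eq_lintegral_condExp_mul [IsFiniteMeasure P] (hm : m ≤ mΩ) (hm' : m' ≤ mΩ)
    {D : Set Ω} (hD : MeasurableSet D)
    (hind : ∀ S, MeasurableSet[m'] S → P⟦D ∩ S | m⟧ =ᵐ[P] P⟦D | m⟧ * P⟦S | m⟧)
    (hf : Measurable[m ⊔ m'] f) :
    ∫⁻ ω in D, f ω ∂P = ∫⁻ ω, ENNReal.ofReal ((P⟦D | m⟧) ω) * f ω ∂P := by
  have hle : m ⊔ m' ≤ mΩ := sup_le hm hm'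
  set ρ := P.withDensity fun ω ↦ ENNReal.ofReal ((P⟦D | m⟧) ω) with hρ
  have hpi (B : Set Ω)
      (hB : B ∈ Set.image2 (· ∩ ·) {S | MeasurableSet[m'] S} {A | MeasurableSet[m] A}) :
      P.restrict D B = ρ B := by
    obtain ⟨S, hS, A, hA, rfl⟩ := hB
    rw [hρ, withDensity_apply _ ((hm' S hS).inter (hm A hA)),
      ← measure_inter_inter_eq_setLIntegral_condExp hm hD (hm' S hS) (hind S hS) hA,
      Measure.restrict_apply ((hm' S hS).inter (hm A hA)), Set.inter_comm, Set.inter_assoc]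
  have htrim : (P.restrict D).trim hle = ρ.trim hle := by
    refine ext_of_generate_finite _ (generateFrom_image2_inter_eq_sup m m').symm
      (isPiSystem_image2_inter m m') (fun B hB ↦ ?_) ?_
    · have hBm : MeasurableSet[m ⊔ m'] B := by
        rw [← generateFrom_image2_inter_eq_sup]
        exact MeasurableSpace.measurableSet_generateFrom hB
      rw [trim_measurableSet_eq hle hBm, trim_measurableSet_eq hle hBm, hpi B hB]
    · rw [trim_measurableSet_eq hle .univ, trim_measurableSet_eq hle .univ]
      exact hpi _ ⟨_, .univ, _, .univ, Set.univ_inter _⟩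
  rw [← lintegral_trim hle hf, htrim, lintegral_trim hle hf, hρ,
    lintegral_withDensity_eq_lintegral_mul _
      (stronglyMeasurable_condExp.mono hm).measurable.ennreal_ofReal (hf.mono hle le_rfl)]
  rfl

-- By conditional independence, `D` can be replaced by its conditional probability, which is a
-- legitimate test function.
lemma CondMeanLEOne.restrict_of_condIndep [IsFiniteMeasure P] (hm : m ≤ mΩ) (hm' : m' ≤ mΩ)
    {D : Set Ω} (hD : MeasurableSet D)
    (hind : ∀ S, MeasurableSet[m'] S → P⟦D ∩ S | m⟧ =ᵐ[P] P⟦D | m⟧ * P⟦S | m⟧)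
    (hf : Measurable[m ⊔ m'] f) (h : CondMeanLEOne P m f) : CondMeanLEOne (P.restrict D) m f := by
  intro ψ hψ
  have hψ' : Measurable[m ⊔ m'] ψ := hψ.mono le_sup_left le_rfl
  change ∫⁻ ω in D, (ψ * f) ω ∂P ≤ ∫⁻ ω in D, ψ ω ∂P
  rw [setLIntegral_eq_lintegral_condExp_mul hm hm' hD hind (hψ'.mul hf),
    setLIntegral_eq_lintegral_condExp_mul hm hm' hD hind hψ']
  simpa only [Pi.mul_apply, mul_assoc] using
    h _ (stronglyMeasurable_condExp.measurable.ennreal_ofReal.mul hψ)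

section CondLaw

variable {E : Type*} [MeasurableSpace E]

lemma measure_eq_of_forall_rat_preimage_Iic {ρ ν : Measure E} [IsProbabilityMeasure ρ]
    [IsProbabilityMeasure ν] {e : E → ℝ} (he : MeasurableEmbedding e)
    (h : ∀ q : ℚ, ρ (e ⁻¹' Set.Iic (q : ℝ)) = ν (e ⁻¹' Set.Iic (q : ℝ))) : ρ = ν := by
  have hmap : ρ.map e = ν.map e := by
    have := Measure.isProbabilityMeasure_map (μ := ρ) he.measurable.aemeasurable
    have := Measure.isProbabilityMeasure_map (μ := ν) he.measurable.aemeasurable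
    refine ext_of_generate_finite _
      (BorelSpace.measurable_eq.trans Real.borel_eq_generateFrom_Iic_rat)
      Real.isPiSystem_Iic_rat (fun B hB ↦ ?_) (by simp)
    obtain ⟨q, rfl⟩ := Set.mem_iUnion.mp hB
    simpa only [Measure.map_apply he.measurable measurableSet_Iic] using h q
  rw [← he.comap_map ρ, hmap, he.comap_map]

variable [StandardBorelSpace E]

lemma ae_eq_of_forall_ae_apply_eq {α : Type*} [MeasurableSpace α] {P : Measure α}
    {ρ ν : α → Measure E} [∀ x, IsProbabilityMeasure (ρ x)] [∀ x, IsProbabilityMeasure (ν x)]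
    (h : ∀ A, MeasurableSet A → ∀ᵐ x ∂P, ρ x A = ν x A) : ∀ᵐ x ∂P, ρ x = ν x := by
  obtain ⟨e, he⟩ := exists_measurableEmbedding_real E
  filter_upwards [ae_all_iff.mpr fun q : ℚ ↦
    h (e ⁻¹' Set.Iic (q : ℝ)) (he.measurable measurableSet_Iic)] with x hx
  exact measure_eq_of_forall_rat_preimage_Iic he hx

variable [Nonempty E] [IsFiniteMeasure P] {Y : Ω → E} {ν : Ω → Measure E}
  [∀ ω, IsProbabilityMeasure (ν ω)]

lemma lintegral_prodMk_eq_lintegral_condLaw {β : Type*} {mβ : MeasurableSpace β} {X : Ω → β}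
    (hX : Measurable X) (hY : Measurable Y)
    (hν : ∀ A, MeasurableSet A → P⟦Y ⁻¹' A | mβ.comap X⟧ =ᵐ[P] fun ω ↦ (ν ω).real A)
    {F : β × E → ℝ≥0∞} (hF : Measurable F) :
    ∫⁻ ω, F (X ω, Y ω) ∂P = ∫⁻ ω, ∫⁻ y, F (X ω, y) ∂(ν ω) ∂P := by
  have hlaw : ∀ᵐ ω ∂P, condDistrib Y X P (X ω) = ν ω := by
    refine ae_eq_of_forall_ae_apply_eq fun A hA ↦ ?_
    filter_upwards [condDistrib_ae_eq_condExp (μ := P) hX hY hA, hν A hA] with ω hcond hA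
    simpa [measureReal_def, ENNReal.toReal_eq_toReal_iff'] using hcond.trans hA
  calc ∫⁻ ω, F (X ω, Y ω) ∂P
      = ∫⁻ z, F z ∂(P.map fun ω ↦ (X ω, Y ω)) := (lintegral_map hF (hX.prodMk hY)).symm
    _ = ∫⁻ x, ∫⁻ y, F (x, y) ∂(condDistrib Y X P x) ∂(P.map X) := by
        rw [← compProd_map_condDistrib hY.aemeasurable, Measure.lintegral_compProd hF]
    _ = ∫⁻ ω, ∫⁻ y, F (X ω, y) ∂(condDistrib Y X P (X ω)) ∂P :=
        lintegral_map hF.lintegral_kernel_prod_right' hX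
    _ = ∫⁻ ω, ∫⁻ y, F (X ω, y) ∂(ν ω) ∂P :=
        lintegral_congr_ae (hlaw.mono fun ω hω ↦ by simp only [hω])

lemma CondMeanLEOne.of_condLaw (hm : m ≤ mΩ) (hY : Measurable Y)
    (hν : ∀ A, MeasurableSet A → P⟦Y ⁻¹' A | m⟧ =ᵐ[P] fun ω ↦ (ν ω).real A) {F : Ω × E → ℝ≥0∞}
    (hF : Measurable[m.prod inferInstance] F) (hmean : ∀ ω, ∫⁻ y, F (ω, y) ∂(ν ω) ≤ 1) :
    CondMeanLEOne P m fun ω ↦ F (ω, Y ω) := by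
  intro ψ hψ
  have hψF : Measurable[m.prod inferInstance] fun z : Ω × E ↦ ψ z.1 * F z :=
    (hψ.comp measurable_fst).mul hF
  calc ∫⁻ ω, ψ ω * F (ω, Y ω) ∂P = ∫⁻ ω, ∫⁻ y, ψ ω * F (ω, y) ∂(ν ω) ∂P :=
        lintegral_prodMk_eq_lintegral_condLaw (mβ := m) (X := id) (measurable_id'' hm) hY
          (by rwa [MeasurableSpace.comap_id]) hψF
    _ ≤ ∫⁻ ω, ψ ω ∂P := by
        refine lintegral_mono fun ω ↦ ?_
        have hsection : Measurable fun y ↦ F (ω, y) := hF.comp measurable_prodMk_left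
        rw [lintegral_const_mul _ hsection]
        exact mul_le_of_le_one_right' (hmean ω)

end CondLaw

section Filtration

variable {𝓕 : ℕ → MeasurableSpace Ω} {s T : ℕ}

lemma lintegral_prod_le_one [IsProbabilityMeasure P] (hmono : Monotone 𝓕) {f : ℕ → Ω → ℝ≥0∞}
    (hf : ∀ t ∈ Finset.Ico s T, Measurable[𝓕 (t + 1)] (f t))
    (hc : ∀ t ∈ Finset.Ico s T, CondMeanLEOne P (𝓕 t) (f t)) :
    ∫⁻ ω, ∏ t ∈ Finset.Ico s T, f t ω ∂P ≤ 1 := by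
  induction T with
  | zero => simp
  | succ T ih =>
    rcases lt_or_ge T s with hT | hT
    · simp [Finset.Ico_eq_empty_of_le (Nat.succ_le_of_lt hT)]
    have hsub : Finset.Ico s T ⊆ Finset.Ico s (T + 1) := Finset.Ico_subset_Ico_right T.le_succ
    simp only [Finset.prod_Ico_succ_top hT]
    refine (hc T (Finset.mem_Ico.mpr ⟨hT, T.lt_succ_self⟩) _ ?_).trans
      (ih (fun t ht ↦ hf t (hsub ht)) fun t ht ↦ hc t (hsub ht))
    exact Finset.measurable_prod _ fun t ht ↦
      (hf t (hsub ht)).mono (hmono (Finset.mem_Ico.mp ht).2) le_rfl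

lemma measure_log_inv_lt_sum_le [IsProbabilityMeasure P] (hmono : Monotone 𝓕)
    (hle : ∀ t, 𝓕 t ≤ mΩ) {ξ : ℕ → Ω → ℝ}
    (hξ : ∀ t ∈ Finset.Ico s T, Measurable[𝓕 (t + 1)] (ξ t))
    (hc : ∀ t ∈ Finset.Ico s T, CondMeanLEOne P (𝓕 t) fun ω ↦ ENNReal.ofReal (Real.exp (ξ t ω)))
    {ε : ℝ} (hε : 0 < ε) :
    P {ω | Real.log (1 / ε) < ∑ t ∈ Finset.Ico s T, ξ t ω} ≤ ENNReal.ofReal ε := by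
  have hmeas : Measurable fun ω ↦ ENNReal.ofReal (Real.exp (∑ t ∈ Finset.Ico s T, ξ t ω)) :=
    (Real.measurable_exp.comp (Finset.measurable_sum _ fun t ht ↦
      (hξ t ht).mono (hle _) le_rfl)).ennreal_ofReal
  have hmean : ∫⁻ ω, ENNReal.ofReal (Real.exp (∑ t ∈ Finset.Ico s T, ξ t ω)) ∂P ≤ 1 := by
    simp only [Real.exp_sum, ENNReal.ofReal_prod_of_nonneg fun _ _ ↦ (Real.exp_pos _).le]
    exact lintegral_prod_le_one hmono
      (fun t ht ↦ (Real.measurable_exp.comp (hξ t ht)).ennreal_ofReal) hc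
  calc P {ω | Real.log (1 / ε) < ∑ t ∈ Finset.Ico s T, ξ t ω}
      ≤ P {ω | ENNReal.ofReal (1 / ε) ≤
          ENNReal.ofReal (Real.exp (∑ t ∈ Finset.Ico s T, ξ t ω))} :=
        measure_mono fun ω hω ↦ ENNReal.ofReal_le_ofReal
          ((Real.log_le_iff_le_exp (by positivity)).mp (le_of_lt hω))
    _ ≤ (∫⁻ ω, ENNReal.ofReal (Real.exp (∑ t ∈ Finset.Ico s T, ξ t ω)) ∂P) /
          ENNReal.ofReal (1 / ε) :=
        meas_ge_le_lintegral_div hmeas.aemeasurable (by simpa using hε) ENNReal.ofReal_ne_top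
    _ ≤ 1 / ENNReal.ofReal (1 / ε) := ENNReal.div_le_div_right hmean _
    _ = ENNReal.ofReal ε := by
        rw [← ENNReal.ofReal_one, ← ENNReal.ofReal_div_of_pos (by positivity), one_div_one_div]

end Filtration

end CondMean

/-! ### Gaussian integrals -/

section RealGaussian

lemma exp_quadratic_mul_gaussianPDFReal {c : ℝ} (hc : 0 < c) (B z : ℝ) :
    Real.exp (B * z - (c - 1) * z ^ 2 / 2) * gaussianPDFReal 0 1 z =
      (√c)⁻¹ * Real.exp (B ^ 2 / (2 * c)) * gaussianPDFReal (B / c) c.toNNReal⁻¹ z := by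
  have hexp : B * z - (c - 1) * z ^ 2 / 2 + -(z - 0) ^ 2 / (2 * 1) =
      B ^ 2 / (2 * c) + -(z - B / c) ^ 2 / (2 * c⁻¹) := by
    field_simp
    ring
  have hsqrt : √(2 * Real.pi * 1) = √c * √(2 * Real.pi * c⁻¹) := by
    rw [← Real.sqrt_mul hc.le]
    field_simp
  simp only [gaussianPDFReal, NNReal.coe_inv, Real.coe_toNNReal c hc.le, NNReal.coe_one]
  rw [mul_left_comm, ← Real.exp_add, hexp, Real.exp_add, hsqrt, mul_inv]
  ring

lemma lintegral_exp_quadratic_gaussianReal {c : ℝ} (hc : 0 < c) (B : ℝ) :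
    ∫⁻ z, ENNReal.ofReal (Real.exp (B * z - (c - 1) * z ^ 2 / 2)) ∂(gaussianReal 0 1) =
      ENNReal.ofReal ((√c)⁻¹ * Real.exp (B ^ 2 / (2 * c))) := by
  have hpdf (z : ℝ) : gaussianPDF 0 1 z * ENNReal.ofReal (Real.exp (B * z - (c - 1) * z ^ 2 / 2)) =
      ENNReal.ofReal ((√c)⁻¹ * Real.exp (B ^ 2 / (2 * c))) *
        gaussianPDF (B / c) c.toNNReal⁻¹ z := by
    rw [gaussianPDF, gaussianPDF, mul_comm, ← ENNReal.ofReal_mul (Real.exp_pos _).le,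
      ← ENNReal.ofReal_mul (by positivity), exp_quadratic_mul_gaussianPDFReal hc]
  rw [gaussianReal_of_var_ne_zero _ one_ne_zero, lintegral_withDensity_eq_lintegral_mul _
    (measurable_gaussianPDF 0 1) (by fun_prop)]
  simp only [Pi.mul_apply, hpdf]
  rw [lintegral_const_mul _ (measurable_gaussianPDF _ _),
    lintegral_gaussianPDF_eq_one _ (by simpa using hc), mul_one]

lemma lintegral_exp_sq_div_four_gaussianReal :
    ∫⁻ z, ENNReal.ofReal (Real.exp (z ^ 2 / 4)) ∂(gaussianReal 0 1) = ENNReal.ofReal √2 := by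
  have h := lintegral_exp_quadratic_gaussianReal (c := 1 / 2) (by norm_num) 0
  convert h using 4
  · ring_nf
  · simp

-- The Chernoff exponent `(x + R * √w * z) / R ^ 2` is Gaussian with mean `x / R ^ 2` and variance
-- `w / R ^ 2`.
lemma lintegral_exp_mul_sub_gaussianReal {R w : ℝ} (hR : R ≠ 0) (hw : 0 ≤ w) (η x : ℝ) :
    ∫⁻ z, ENNReal.ofReal (Real.exp ((x + R * √w * z) / R ^ 2 * η -
        ((x + R * √w * z) / R ^ 2) ^ 2 * R ^ 2 / 2)) ∂(gaussianReal 0 1) =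
      ENNReal.ofReal ((√(1 + w))⁻¹ *
        Real.exp ((2 * η * x + η ^ 2 * w - x ^ 2) / (1 + w) / (2 * R ^ 2))) := by
  have hexp (z : ℝ) : (x + R * √w * z) / R ^ 2 * η -
      ((x + R * √w * z) / R ^ 2) ^ 2 * R ^ 2 / 2 = (2 * x * η - x ^ 2) / (2 * R ^ 2) +
        (√w * (η - x) / R * z - (1 + w - 1) * z ^ 2 / 2) := by
    have hsq := Real.sq_sqrt hw
    field_simp
    linear_combination (-R ^ 2 * z ^ 2) * hsq
  simp only [hexp, Real.exp_add, ENNReal.ofReal_mul (Real.exp_pos _).le]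
  rw [lintegral_const_mul _ (by fun_prop), lintegral_exp_quadratic_gaussianReal (by positivity),
    ← ENNReal.ofReal_mul (Real.exp_pos _).le, mul_left_comm, ← Real.exp_add]
  congr 3
  rw [div_pow, mul_pow, Real.sq_sqrt hw]
  field_simp
  ring

lemma gaussianReal_Ici_pos (κ : ℝ) : 0 < (gaussianReal 0 1).real (Set.Ici κ) := by
  refine ENNReal.toReal_pos (fun h ↦ ?_) (measure_ne_top _ _)
  simpa using gaussianReal_absolutelyContinuous' 0 one_ne_zero h

end RealGaussian

section MultivariateGaussian

open Matrix
open scoped MatrixOrder ENNReal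

variable {n α : Type*} [Fintype n]

lemma lintegral_exp_sq_norm_stdGaussian :
    ∫⁻ z, ENNReal.ofReal (Real.exp (‖z‖ ^ 2 / 4)) ∂(stdGaussian (EuclideanSpace ℝ n)) =
      ENNReal.ofReal √2 ^ Fintype.card n := by
  set f : ℝ → ℝ≥0∞ := fun y ↦ ENNReal.ofReal (Real.exp (y ^ 2 / 4))
  set ρ : Measure (n → ℝ) := Measure.pi fun _ ↦ gaussianReal 0 1
  have hfm : Measurable f := by fun_prop
  have hprod (x : n → ℝ) : ENNReal.ofReal (Real.exp (‖WithLp.toLp 2 x‖ ^ 2 / 4)) =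
      ∏ i, f (x i) := by
    rw [EuclideanSpace.real_norm_sq_eq, Finset.sum_div, Real.exp_sum,
      ENNReal.ofReal_prod_of_nonneg fun _ _ ↦ (Real.exp_pos _).le]
  have hind : iIndepFun (fun i (x : n → ℝ) ↦ f (x i)) ρ := iIndepFun_pi fun _ ↦ hfm.aemeasurable
  have hcoord (i : n) : ∫⁻ x, f (x i) ∂ρ = ENNReal.ofReal √2 := by
    rw [← lintegral_exp_sq_div_four_gaussianReal]
    exact (measurePreserving_eval (fun _ ↦ gaussianReal 0 1) i).lintegral_comp hfm
  rw [← map_pi_eq_stdGaussian, lintegral_map (by fun_prop) (by fun_prop)]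
  simp only [hprod]
  rw [lintegral_prod_eq_prod_lintegral_of_indepFun Finset.univ _ hind fun i ↦ by fun_prop]
  simp [hcoord]

/-- The largest squared standardized deviation of `x` from `y` in the directions `u i`, for the
covariance matrix `S`. A direction of variance zero counts as zero, by `x / 0 = 0`. -/
def maxDevSq (u : α → EuclideanSpace ℝ n) (y : EuclideanSpace ℝ n) (S : Matrix n n ℝ)
    (x : EuclideanSpace ℝ n) : ℝ :=
  ⨆ i, (inner ℝ (u i) x - inner ℝ (u i) y) ^ 2 / ((u i).ofLp ⬝ᵥ S *ᵥ (u i).ofLp)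

lemma measurable_maxDevSq [Countable α] (u : α → EuclideanSpace ℝ n) (y : EuclideanSpace ℝ n)
    (S : Matrix n n ℝ) : Measurable (maxDevSq u y S) :=
  Measurable.iSup fun i ↦ by fun_prop

variable {S : Matrix n n ℝ}

lemma maxDevSq_nonneg (hS : S.PosSemidef) (u : α → EuclideanSpace ℝ n)
    (x y : EuclideanSpace ℝ n) : 0 ≤ maxDevSq u y S x :=
  Real.iSup_nonneg fun i ↦ div_nonneg (sq_nonneg _) (dotProduct_mulVec_self_nonneg hS (u i).ofLp)

lemma abs_inner_sub_le_sqrt_maxDevSq_mul [Finite α] (hS : S.PosDef) (u : α → EuclideanSpace ℝ n)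
    (x y : EuclideanSpace ℝ n) (i : α) :
    |inner ℝ (u i) x - inner ℝ (u i) y| ≤
      √(maxDevSq u y S x) * √((u i).ofLp ⬝ᵥ S *ᵥ (u i).ofLp) := by
  rcases eq_or_ne (u i) 0 with hzero | hne
  · simp [hzero]
  · have hpos : 0 < (u i).ofLp ⬝ᵥ S *ᵥ (u i).ofLp := by
      simpa using hS.dotProduct_mulVec_pos fun h ↦ hne (congrArg (WithLp.toLp 2) h)
    rw [← Real.sqrt_mul (maxDevSq_nonneg hS.posSemidef u x y)]
    refine Real.abs_le_sqrt ((div_le_iff₀ hpos).mp ?_)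
    exact le_ciSup (f := fun i ↦ (inner ℝ (u i) x - inner ℝ (u i) y) ^ 2 /
      ((u i).ofLp ⬝ᵥ S *ᵥ (u i).ofLp)) (Set.finite_range _).bddAbove i

/-- The samples `x` whose best mean reward is at least that of the true parameter `θ`, while `x`
stays close to `y` in the sense of `maxDevSq`. -/
def optimisticSet (u : α → EuclideanSpace ℝ n) (y θ : EuclideanSpace ℝ n) (S : Matrix n n ℝ)
    (M : ℝ) : Set (EuclideanSpace ℝ n) :=
  {x | (⨆ j, inner ℝ (u j) θ) ≤ ⨆ j, inner ℝ (u j) x ∧ maxDevSq u y S x ≤ M}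

variable [DecidableEq n]

lemma inner_sqrt_apply (x z : EuclideanSpace ℝ n) :
    inner ℝ x (toEuclideanCLM (𝕜 := ℝ) (CFC.sqrt S) z) =
      inner ℝ (toEuclideanCLM (𝕜 := ℝ) (CFC.sqrt S) x) z := by
  rw [← ContinuousLinearMap.adjoint_inner_left,
    IsSelfAdjoint.adjoint_eq ((CFC.sqrt_nonneg S).isSelfAdjoint.map _)]

variable (hS : S.PosSemidef)

include hS

lemma norm_sq_sqrt_apply (x : EuclideanSpace ℝ n) :
    ‖toEuclideanCLM (𝕜 := ℝ) (CFC.sqrt S) x‖ ^ 2 = x.ofLp ⬝ᵥ S *ᵥ x.ofLp := by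
  rw [← real_inner_self_eq_norm_sq, ← inner_sqrt_apply, ← ContinuousLinearMap.comp_apply,
    ← ContinuousLinearMap.mul_def, ← map_mul, CFC.sqrt_mul_sqrt_self _ hS.nonneg,
    inner_toEuclideanCLM]

lemma map_inner_multivariateGaussian (u y : EuclideanSpace ℝ n) :
    (multivariateGaussian y S).map (fun x ↦ inner ℝ u x) =
      (gaussianReal 0 1).map fun z ↦ inner ℝ u y + √(u.ofLp ⬝ᵥ S *ᵥ u.ofLp) * z := by
  set c := toEuclideanCLM (𝕜 := ℝ) (CFC.sqrt S) u with hc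
  have hnorm : √(u.ofLp ⬝ᵥ S *ᵥ u.ofLp) = ‖c‖ := by
    rw [← norm_sq_sqrt_apply hS, Real.sqrt_sq (norm_nonneg _)]
  have hstd : (stdGaussian (EuclideanSpace ℝ n)).map (innerSL ℝ c) =
      (gaussianReal 0 1).map (‖c‖ * ·) := by
    rw [IsGaussian.map_eq_gaussianReal, integral_strongDual_stdGaussian,
      variance_dual_stdGaussian, innerSL_apply_norm, gaussianReal_map_const_mul, mul_zero, mul_one]
    congr 1
    exact Subtype.ext (Real.coe_toNNReal _ (sq_nonneg _))
  rw [multivariateGaussian, Measure.map_map (by fun_prop) (by fun_prop), hnorm,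
    ← Function.comp_def (inner ℝ u y + ·) (‖c‖ * ·),
    ← Measure.map_map (g := (inner ℝ u y + ·)) (by fun_prop) (by fun_prop), ← hstd,
    Measure.map_map (by fun_prop) (by fun_prop)]
  congr 1
  ext z
  simp [inner_add_right, inner_sqrt_apply, hc]

lemma gaussianReal_Ici_le_multivariateGaussian (u y : EuclideanSpace ℝ n) {κ c : ℝ}
    (h : c - κ * √(u.ofLp ⬝ᵥ S *ᵥ u.ofLp) ≤ inner ℝ u y) :
    gaussianReal 0 1 (Set.Ici κ) ≤ multivariateGaussian y S {x | c ≤ inner ℝ u x} := by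
  have hmap := congrArg (fun ρ : Measure ℝ ↦ ρ (Set.Ici c)) (map_inner_multivariateGaussian hS u y)
  simp only at hmap
  rw [Measure.map_apply (by fun_prop) measurableSet_Ici,
    Measure.map_apply (by fun_prop) measurableSet_Ici] at hmap
  refine (measure_mono fun z (hz : κ ≤ z) ↦ ?_).trans_eq hmap.symm
  have := mul_le_mul_of_nonneg_left hz (Real.sqrt_nonneg (u.ofLp ⬝ᵥ S *ᵥ u.ofLp))
  simp only [Set.mem_preimage, Set.mem_Ici]
  linarith

lemma lintegral_exp_sq_inner_sub_le (u y : EuclideanSpace ℝ n) :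
    ∫⁻ x, ENNReal.ofReal (Real.exp ((inner ℝ u x - inner ℝ u y) ^ 2 /
        (u.ofLp ⬝ᵥ S *ᵥ u.ofLp) / 4)) ∂(multivariateGaussian y S) ≤ ENNReal.ofReal √2 := by
  rw [← lintegral_map (f := fun t : ℝ ↦ ENNReal.ofReal (Real.exp ((t - inner ℝ u y) ^ 2 /
      (u.ofLp ⬝ᵥ S *ᵥ u.ofLp) / 4))) (by fun_prop) (by fun_prop),
    map_inner_multivariateGaussian hS, lintegral_map (by fun_prop) (by fun_prop),
    ← lintegral_exp_sq_div_four_gaussianReal]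
  have hvar : 0 ≤ u.ofLp ⬝ᵥ S *ᵥ u.ofLp := hS.dotProduct_mulVec_nonneg _
  refine lintegral_mono fun z ↦ ENNReal.ofReal_le_ofReal (Real.exp_le_exp.mpr ?_)
  rw [add_sub_cancel_left, mul_pow, Real.sq_sqrt hvar]
  gcongr
  exact div_le_of_le_mul₀ hvar (sq_nonneg z) (mul_comm _ _).le

lemma lintegral_exp_maxDevSq_le_card_mul [Fintype α] [Nonempty α] (u : α → EuclideanSpace ℝ n)
    (y : EuclideanSpace ℝ n) :
    ∫⁻ x, ENNReal.ofReal (Real.exp (maxDevSq u y S x / 4)) ∂(multivariateGaussian y S) ≤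
      Fintype.card α * ENNReal.ofReal √2 := by
  calc _ ≤ ∫⁻ x, ∑ i, ENNReal.ofReal (Real.exp ((inner ℝ (u i) x - inner ℝ (u i) y) ^ 2 /
          ((u i).ofLp ⬝ᵥ S *ᵥ (u i).ofLp) / 4)) ∂(multivariateGaussian y S) := by
        refine lintegral_mono fun x ↦ ?_
        obtain ⟨i, hi⟩ := exists_eq_ciSup_of_finite (f := fun i ↦
          (inner ℝ (u i) x - inner ℝ (u i) y) ^ 2 / ((u i).ofLp ⬝ᵥ S *ᵥ (u i).ofLp))
        rw [maxDevSq, ← hi]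
        exact Finset.single_le_sum_of_canonicallyOrdered
          (f := fun i ↦ ENNReal.ofReal (Real.exp ((inner ℝ (u i) x - inner ℝ (u i) y) ^ 2 /
          ((u i).ofLp ⬝ᵥ S *ᵥ (u i).ofLp) / 4))) (Finset.mem_univ i)
    _ ≤ ∑ _i : α, ENNReal.ofReal √2 := by
        rw [lintegral_finsetSum _ fun i _ ↦ by fun_prop]
        exact Finset.sum_le_sum fun i _ ↦ lintegral_exp_sq_inner_sub_le hS (u i) y
    _ = _ := by simp

lemma lintegral_exp_maxDevSq_le_pow_card [Countable α] [Nonempty α] (u : α → EuclideanSpace ℝ n)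
    (y : EuclideanSpace ℝ n) :
    ∫⁻ x, ENNReal.ofReal (Real.exp (maxDevSq u y S x / 4)) ∂(multivariateGaussian y S) ≤
      ENNReal.ofReal √2 ^ Fintype.card n := by
  have hdev (z : EuclideanSpace ℝ n) :
      maxDevSq u y S (y + toEuclideanCLM (𝕜 := ℝ) (CFC.sqrt S) z) ≤ ‖z‖ ^ 2 := by
    refine ciSup_le fun i ↦ ?_
    rw [inner_add_right, add_sub_cancel_left, inner_sqrt_apply, ← norm_sq_sqrt_apply hS]
    refine div_le_of_le_mul₀ (sq_nonneg _) (sq_nonneg _) ?_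
    rw [← mul_pow, mul_comm]
    exact sq_le_sq' (neg_le_of_abs_le (abs_real_inner_le_norm _ _)) (real_inner_le_norm _ _)
  have hmeas := measurable_maxDevSq u y S
  rw [← lintegral_exp_sq_norm_stdGaussian, multivariateGaussian,
    lintegral_map (by fun_prop) (by fun_prop)]
  gcongr
  exact hdev _

lemma lintegral_exp_maxDevSq_le [Fintype α] (hα : 2 ≤ Fintype.card α)
    (u : α → EuclideanSpace ℝ n) (y : EuclideanSpace ℝ n) :
    ∫⁻ x, ENNReal.ofReal (Real.exp (maxDevSq u y S x / 4)) ∂(multivariateGaussian y S) ≤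
      ENNReal.ofReal (Real.exp (3 / 2 * min (Fintype.card n : ℝ) (Real.log (Fintype.card α)))) := by
  have hpos : 0 < Fintype.card α := by omega
  have : Nonempty α := Fintype.card_pos_iff.mp hpos
  rcases min_choice (Fintype.card n : ℝ) (Real.log (Fintype.card α)) with h | h <;> rw [h]
  · refine (lintegral_exp_maxDevSq_le_pow_card hS u y).trans ?_
    have hsqrt : √2 ≤ Real.exp (1 / 2) := by
      rw [Real.exp_half]
      exact Real.sqrt_le_sqrt (by linarith [Real.add_one_le_exp (1 : ℝ)])
    rw [← ENNReal.ofReal_pow (Real.sqrt_nonneg _)]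
    refine ENNReal.ofReal_le_ofReal ((pow_le_pow_left₀ (Real.sqrt_nonneg _) hsqrt _).trans ?_)
    rw [← Real.exp_nat_mul, Real.exp_le_exp]
    linarith [Nat.cast_nonneg (α := ℝ) (Fintype.card n)]
  · refine (lintegral_exp_maxDevSq_le_card_mul hS u y).trans ?_
    have hcard : Real.exp (Real.log (Fintype.card α)) = Fintype.card α :=
      Real.exp_log (by exact_mod_cast hpos)
    have hsqrt : √2 ≤ Real.exp (1 / 2 * Real.log (Fintype.card α)) := by
      rw [one_div_mul_eq_div, Real.exp_half, hcard]
      exact Real.sqrt_le_sqrt (by exact_mod_cast hα)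
    rw [← ENNReal.ofReal_natCast, ← ENNReal.ofReal_mul (Nat.cast_nonneg _), ← hcard]
    refine ENNReal.ofReal_le_ofReal ((mul_le_mul_of_nonneg_left hsqrt (Real.exp_pos _).le).trans ?_)
    rw [← Real.exp_add, hcard, Real.exp_le_exp]
    linarith

lemma measureReal_lt_maxDevSq_le [Fintype α] (hα : 2 ≤ Fintype.card α)
    (u : α → EuclideanSpace ℝ n) (y : EuclideanSpace ℝ n) (M : ℝ) :
    (multivariateGaussian y S).real {x | M < maxDevSq u y S x} ≤ Real.exp
      (3 / 2 * min (Fintype.card n : ℝ) (Real.log (Fintype.card α)) - M / 4) := by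
  refine ENNReal.toReal_le_of_le_ofReal (Real.exp_pos _).le ?_
  have hmeas := measurable_maxDevSq u y S
  have hexp : 0 < Real.exp (M / 4) := Real.exp_pos _
  have hmarkov := meas_ge_le_lintegral_div (μ := multivariateGaussian y S)
    (f := fun x ↦ ENNReal.ofReal (Real.exp (maxDevSq u y S x / 4))) (by fun_prop)
    (ENNReal.ofReal_pos.mpr hexp).ne' ENNReal.ofReal_ne_top
  rw [Real.exp_sub, ENNReal.ofReal_div_of_pos hexp]
  calc multivariateGaussian y S {x | M < maxDevSq u y S x}
      ≤ multivariateGaussian y S {x | ENNReal.ofReal (Real.exp (M / 4)) ≤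
          ENNReal.ofReal (Real.exp (maxDevSq u y S x / 4))} := by
        refine measure_mono fun x (hx : M < maxDevSq u y S x) ↦ ENNReal.ofReal_le_ofReal ?_
        gcongr
    _ ≤ _ := hmarkov.trans (ENNReal.div_le_div_right (lintegral_exp_maxDevSq_le hS hα u y) _)

-- Sampling above the true mean reward of the best arm alone already makes a sample optimistic.
lemma le_measureReal_optimisticSet [Fintype α] (hα : 2 ≤ Fintype.card α)
    {u : α → EuclideanSpace ℝ n} {y θ : EuclideanSpace ℝ n} {κ q M : ℝ}
    (hy : ∀ i, |inner ℝ (u i) y - inner ℝ (u i) θ| ≤ κ * √((u i).ofLp ⬝ᵥ S *ᵥ (u i).ofLp))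
    (hM : Real.exp
      (3 / 2 * min (Fintype.card n : ℝ) (Real.log (Fintype.card α)) - M / 4) ≤ q)
    (hq : 2 * q ≤ (gaussianReal 0 1).real (Set.Ici κ)) :
    q ≤ (multivariateGaussian y S).real (optimisticSet u y θ S M) := by
  have : Nonempty α := Fintype.card_pos_iff.mp (by omega)
  obtain ⟨j, hj⟩ := exists_eq_ciSup_of_finite (f := fun j ↦ (inner ℝ (u j) θ : ℝ))
  have hbest : (gaussianReal 0 1).real (Set.Ici κ) ≤
      (multivariateGaussian y S).real {x | inner ℝ (u j) θ ≤ inner ℝ (u j) x} :=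
    ENNReal.toReal_mono (measure_ne_top _ _) <|
      gaussianReal_Ici_le_multivariateGaussian hS _ _ <| by
        linarith [neg_abs_le (inner ℝ (u j) y - inner ℝ (u j) θ), hy j]
  have hsubset : {x | inner ℝ (u j) θ ≤ inner ℝ (u j) x} ⊆
      optimisticSet u y θ S M ∪ {x | M < maxDevSq u y S x} := by
    refine fun x hx ↦ (le_or_gt (maxDevSq u y S x) M).imp (fun hdev ↦ ⟨?_, hdev⟩) id
    rw [← hj]
    exact le_trans hx (le_ciSup (f := fun j ↦ (inner ℝ (u j) x : ℝ))
      (Set.finite_range _).bddAbove j)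
  have hunion := (measureReal_mono (μ := multivariateGaussian y S) hsubset).trans
    (measureReal_union_le _ _)
  linarith [measureReal_lt_maxDevSq_le hS hα u y M]

end MultivariateGaussian

/-! ### Measurability with respect to the history -/

section Measurability

open Matrix

variable {Ω : Type*} {d N : ℕ}

section MeasurableMatrix

variable {mΩ : MeasurableSpace Ω}

lemma measurable_apply_index {ι β : Type*} [Countable ι] [MeasurableSpace ι]
    [DiscreteMeasurableSpace ι] [MeasurableSpace β] {f : ι → Ω → β} (hf : ∀ i, Measurable (f i))
    {k : Ω → ι} (hk : Measurable k) : Measurable fun ω ↦ f (k ω) ω :=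
  (measurable_from_prod_countable_right (f := fun p : ι × Ω ↦ f p.1 p.2) hf).comp
    (hk.prodMk measurable_id)

variable {n : Type*} [Fintype n]

lemma measurable_dotProduct {u w : Ω → n → ℝ} (hu : Measurable u) (hw : Measurable w) :
    Measurable fun ω ↦ u ω ⬝ᵥ w ω := by
  simp only [dotProduct]
  fun_prop

lemma measurable_mulVec {A : Ω → Matrix n n ℝ} (hA : ∀ i j, Measurable fun ω ↦ A ω i j)
    {u : Ω → n → ℝ} (hu : Measurable u) : Measurable fun ω ↦ A ω *ᵥ u ω :=
  measurable_pi_lambda _ fun i ↦ measurable_dotProduct (measurable_pi_lambda _ (hA i)) hu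

variable [DecidableEq n]

lemma measurable_det {A : Ω → Matrix n n ℝ} (hA : ∀ i j, Measurable fun ω ↦ A ω i j) :
    Measurable fun ω ↦ (A ω).det := by
  simp only [det_apply]
  fun_prop

lemma measurable_inv_apply {A : Ω → Matrix n n ℝ} (hA : ∀ i j, Measurable fun ω ↦ A ω i j)
    (i j : n) : Measurable fun ω ↦ (A ω)⁻¹ i j := by
  have hadj : Measurable fun ω ↦ (A ω).adjugate i j := by
    simp only [adjugate_apply]
    refine measurable_det fun k l ↦ ?_
    simp only [updateRow_apply]
    split_ifs
    · exact measurable_const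
    · exact hA k l
  simp only [Matrix.inv_def, Ring.inverse_eq_inv', Matrix.smul_apply, smul_eq_mul]
  exact (measurable_det hA).inv.mul hadj

end MeasurableMatrix

variable {μ : Vec d} {b : ℕ → Fin N → Ω → Vec d} {r : ℕ → Fin N → Ω → ℝ} {a : ℕ → Ω → Fin N}
  {t τ : ℕ}

lemma le_history (hτ : τ ∈ Finset.Ico 1 t) :
    MeasurableSpace.comap (a τ) inferInstance ⊔
      MeasurableSpace.comap (fun ω ↦ r τ (a τ ω) ω) inferInstance ⊔
      ⨆ i, MeasurableSpace.comap (b τ i) inferInstance ≤ history b r a t :=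
  le_iSup₂_of_le (f := fun τ (_ : τ ∈ Finset.Ico 1 t) ↦
    MeasurableSpace.comap (a τ) inferInstance ⊔
      MeasurableSpace.comap (fun ω ↦ r τ (a τ ω) ω) inferInstance ⊔
      ⨆ i, MeasurableSpace.comap (b τ i) inferInstance) τ hτ le_rfl

lemma measurable_context_info (i : Fin N) : Measurable[info b r a t] (b t i) :=
  Measurable.of_comap_le ((le_iSup (fun i ↦ MeasurableSpace.comap (b t i) inferInstance) i).trans
    le_sup_right)

lemma info_le_info_succ (ht : 1 ≤ t) : info b r a t ≤ info b r a (t + 1) := by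
  refine sup_le (iSup₂_le fun τ hτ ↦ ?_) ?_
  · exact (le_history (Finset.Ico_subset_Ico_right t.le_succ hτ)).trans le_sup_left
  · exact le_sup_right.trans ((le_history (Finset.mem_Ico.mpr ⟨ht, t.lt_succ_self⟩)).trans
      le_sup_left)

lemma monotone_info : Monotone fun t ↦ info b r a (max 1 t) := by
  refine monotone_nat_of_le_succ fun t ↦ ?_
  rcases Nat.eq_zero_or_pos t with rfl | ht
  · simp
  · rw [max_eq_right (by omega), max_eq_right (by omega)]
    exact info_le_info_succ ht

lemma measurable_arm_info (hτ : τ ∈ Finset.Ico 1 t) : Measurable[info b r a t] (a τ) :=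
  Measurable.of_comap_le ((le_sup_left.trans le_sup_left).trans
    ((le_history hτ).trans le_sup_left))

lemma measurable_playedReward_info (hτ : τ ∈ Finset.Ico 1 t) :
    Measurable[info b r a t] fun ω ↦ r τ (a τ ω) ω :=
  Measurable.of_comap_le ((le_sup_right.trans le_sup_left).trans
    ((le_history hτ).trans le_sup_left))

lemma measurable_playedContext_info (hτ : τ ∈ Finset.Ico 1 t) :
    Measurable[info b r a t] fun ω ↦ b τ (a τ ω) ω :=
  measurable_apply_index (fun i ↦ Measurable.of_comap_le
    (((le_iSup (fun i ↦ MeasurableSpace.comap (b τ i) inferInstance) i).trans le_sup_right).trans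
      ((le_history hτ).trans le_sup_left))) (measurable_arm_info hτ)

lemma measurable_ofLp_playedContext_info (hτ : τ ∈ Finset.Ico 1 t) :
    Measurable[info b r a t] fun ω ↦ (b τ (a τ ω) ω).ofLp :=
  (WithLp.measurable_ofLp 2 _).comp (measurable_playedContext_info hτ)

lemma measurable_designMatrix_apply_info (i j : Fin d) :
    Measurable[info b r a t] fun ω ↦ designMatrix b a t ω i j := by
  simp only [designMatrix, Matrix.add_apply, Matrix.sum_apply, vecMulVec_apply]
  refine measurable_const.add (Finset.measurable_sum _ fun τ hτ ↦ ?_)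
  have hu (k : Fin d) : Measurable[info b r a t] fun ω ↦ (b τ (a τ ω) ω).ofLp k :=
    (measurable_pi_apply k).comp (measurable_ofLp_playedContext_info hτ)
  exact (hu i).mul (hu j)

lemma measurable_inv_designMatrix_apply_info (i j : Fin d) :
    Measurable[info b r a t] fun ω ↦ (designMatrix b a t ω)⁻¹ i j :=
  measurable_inv_apply measurable_designMatrix_apply_info i j

lemma measurable_playedNoise_info (hτ : τ ∈ Finset.Ico 1 t) :
    Measurable[info b r a t] fun ω ↦ playedNoise μ b r a ω τ :=
  (measurable_playedReward_info hτ).sub (measurable_playedContext_info hτ).inner_const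

lemma measurable_noiseSum_info : Measurable[info b r a t] (noiseSum μ b r a t) :=
  Finset.measurable_sum _ fun _ hτ ↦
    (measurable_playedNoise_info hτ).smul (measurable_ofLp_playedContext_info hτ)

lemma measurable_selfNormSq_info : Measurable[info b r a t] (selfNormSq μ b r a t) :=
  measurable_dotProduct measurable_noiseSum_info
    (measurable_mulVec measurable_inv_designMatrix_apply_info measurable_noiseSum_info)

lemma measurable_ofLp_context_info (i : Fin N) :
    Measurable[info b r a t] fun ω ↦ (b t i ω).ofLp :=
  (WithLp.measurable_ofLp 2 _).comp (measurable_context_info i)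

lemma measurable_noiseDrift_info (i : Fin N) :
    Measurable[info b r a t] (noiseDrift μ b r a t i) :=
  measurable_dotProduct (measurable_ofLp_context_info i)
    (measurable_mulVec measurable_inv_designMatrix_apply_info measurable_noiseSum_info)

lemma measurable_width_info (i : Fin N) : Measurable[info b r a t] (width b a t i) :=
  (measurable_dotProduct (measurable_ofLp_context_info i) (measurable_mulVec
    measurable_inv_designMatrix_apply_info (measurable_ofLp_context_info i))).sqrt

lemma measurable_estimate_info : Measurable[info b r a t] (estimate b r a t) :=
  (WithLp.measurable_toLp 2 _).comp <| measurable_mulVec measurable_inv_designMatrix_apply_info <|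
    Finset.measurable_sum _ fun _ hτ ↦
      (measurable_playedReward_info hτ).smul (measurable_ofLp_playedContext_info hτ)

lemma measurable_gap_info (i : Fin N) : Measurable[info b r a t] (gap μ b t i) :=
  (Measurable.iSup fun j ↦ (measurable_context_info j).inner_const).sub
    (measurable_context_info i).inner_const

variable {mΩ : MeasurableSpace Ω} {P : Measure Ω} {R : ℝ}

lemma IsLinearBandit.info_le (hB : IsLinearBandit P R μ b r a) (ht : 1 ≤ t) :
    info b r a t ≤ mΩ := by
  refine sup_le (iSup₂_le fun τ hτ ↦ ?_) (iSup_le fun i ↦ (hB.measurable_context t ht i).comap_le)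
  have hτ1 := (Finset.mem_Ico.mp hτ).1
  exact sup_le (sup_le (hB.measurable_arm τ hτ1).comap_le
    (measurable_apply_index (hB.measurable_reward τ hτ1) (hB.measurable_arm τ hτ1)).comap_le)
    (iSup_le fun i ↦ (hB.measurable_context τ hτ1 i).comap_le)

end Measurability

/-! ### The self-normalized noise bound -/

section SelfNormalized

open Matrix
open scoped ENNReal

variable {Ω : Type*} {m mΩ : MeasurableSpace Ω} {P : Measure Ω} {R : ℝ}

lemma CondMeanLEOne.gaussian_mixture [SFinite P] (hm : m ≤ mΩ)
    (hR : R ≠ 0) {η x w : Ω → ℝ} (hη : Measurable η)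
    (h : ∀ l : ℝ, CondMeanLEOne P m
      fun ω ↦ ENNReal.ofReal (Real.exp (l * η ω - l ^ 2 * R ^ 2 / 2)))
    (hx : Measurable[m] x) (hw : Measurable[m] w) (hw0 : ∀ ω, 0 ≤ w ω) :
    CondMeanLEOne P m fun ω ↦ ENNReal.ofReal ((√(1 + w ω))⁻¹ *
      Real.exp ((2 * η ω * x ω + η ω ^ 2 * w ω - x ω ^ 2) / (1 + w ω) / (2 * R ^ 2))) := by
  have hx' : Measurable x := hx.mono hm le_rfl
  have hw' : Measurable w := hw.mono hm le_rfl
  simp only [← lintegral_exp_mul_sub_gaussianReal hR (hw0 _)]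
  refine CondMeanLEOne.lintegral hm (by fun_prop) fun z ↦ ?_
  exact CondMeanLEOne.comp_stronglyMeasurable hm (by fun_prop)
    (fun ω ↦ ENNReal.continuous_ofReal.comp (by fun_prop)) h
    ((hx.add ((hw.sqrt.const_mul R).mul_const z)).div_const (R ^ 2)).stronglyMeasurable

variable {d N : ℕ} {μ : Vec d} {v : ℕ → ℝ} {b : ℕ → Fin N → Ω → Vec d} {r : ℕ → Fin N → Ω → ℝ}
  {a : ℕ → Ω → Fin N} {s : ℕ → Ω → Vec d} {t : ℕ}

/-- The logarithmic increment of the self-normalized exponential supermartingale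
`exp (selfNormSq / (2 R²)) / √(det B(t))`. -/
def selfNormIncrement (R : ℝ) (μ : Vec d) (b : ℕ → Fin N → Ω → Vec d) (r : ℕ → Fin N → Ω → ℝ)
    (a : ℕ → Ω → Fin N) (t : ℕ) (ω : Ω) : ℝ :=
  (selfNormSq μ b r a (t + 1) ω / (2 * R ^ 2) - Real.log (designMatrix b a (t + 1) ω).det / 2) -
    (selfNormSq μ b r a t ω / (2 * R ^ 2) - Real.log (designMatrix b a t ω).det / 2)

lemma sum_selfNormIncrement (ht : 1 ≤ t) (ω : Ω) :
    ∑ τ ∈ Finset.Ico 1 t, selfNormIncrement R μ b r a τ ω =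
      selfNormSq μ b r a t ω / (2 * R ^ 2) - Real.log (designMatrix b a t ω).det / 2 := by
  simp only [selfNormIncrement]
  rw [Finset.sum_Ico_sub (fun τ ↦ selfNormSq μ b r a τ ω / (2 * R ^ 2) -
    Real.log (designMatrix b a τ ω).det / 2) ht, selfNormSq_one, designMatrix_eq_regGram,
    designMatrix_eq_regGram, regGram_one]
  simp

lemma exp_selfNormIncrement (ht : 1 ≤ t) (ω : Ω) :
    Real.exp (selfNormIncrement R μ b r a t ω) =
      (√(1 + width b a t (a t ω) ω ^ 2))⁻¹ *
        Real.exp ((2 * playedNoise μ b r a ω t * noiseDrift μ b r a t (a t ω) ω +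
          playedNoise μ b r a ω t ^ 2 * width b a t (a t ω) ω ^ 2 -
          noiseDrift μ b r a t (a t ω) ω ^ 2) / (1 + width b a t (a t ω) ω ^ 2) /
          (2 * R ^ 2)) := by
  have hdet : 0 < (designMatrix b a t ω).det := (posDef_designMatrix t ω).det_pos
  have hw : 0 < 1 + width b a t (a t ω) ω ^ 2 := by positivity
  have hsqrt : (√(1 + width b a t (a t ω) ω ^ 2))⁻¹ =
      Real.exp (-(Real.log (1 + width b a t (a t ω) ω ^ 2) / 2)) := by
    rw [Real.exp_neg, Real.exp_half, Real.exp_log hw]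
  rw [hsqrt, ← Real.exp_add, selfNormIncrement, selfNormSq_succ ht, det_designMatrix_succ ht,
    Real.log_mul hdet.ne' hw.ne']
  ring_nf

lemma measurable_selfNormIncrement_info (ht : 1 ≤ t) :
    Measurable[info b r a (t + 1)] (selfNormIncrement R μ b r a t) := by
  have hpotential (t : ℕ) : Measurable[info b r a t] fun ω ↦
      selfNormSq μ b r a t ω / (2 * R ^ 2) - Real.log (designMatrix b a t ω).det / 2 :=
    (measurable_selfNormSq_info.div_const _).sub
      ((measurable_det measurable_designMatrix_apply_info).log.div_const _)
  exact (hpotential (t + 1)).sub ((hpotential t).mono (info_le_info_succ ht) le_rfl)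

variable [IsProbabilityMeasure P]

lemma IsLinearBandit.condMeanLEOne_exp_noise (hB : IsLinearBandit P R μ b r a) (ht : 1 ≤ t)
    (i : Fin N) (l : ℝ) :
    CondMeanLEOne P (info b r a t) fun ω ↦ ENNReal.ofReal
      (Real.exp (l * (r t i ω - inner ℝ (b t i ω) μ) - l ^ 2 * R ^ 2 / 2)) := by
  simp only [Real.exp_sub, div_eq_inv_mul (Real.exp (l * _))]
  refine CondMeanLEOne.of_condExp_le_one (hB.info_le ht)
    ((hB.integrable_exp_noise t ht i l).const_mul _) (ae_of_all _ fun ω ↦ by positivity) ?_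
  filter_upwards [condExp_smul (μ := P) (Real.exp (l ^ 2 * R ^ 2 / 2))⁻¹
    (fun ω ↦ Real.exp (l * (r t i ω - inner ℝ (b t i ω) μ))) (info b r a t),
    hB.subGaussian_noise t ht i l] with ω hsmul hsub
  refine hsmul.trans_le ?_
  rw [Pi.smul_apply, smul_eq_mul, inv_mul_le_iff₀ (Real.exp_pos _)]
  simpa using hsub

lemma condMeanLEOne_restrict_exp_noise (hB : IsLinearBandit P R μ b r a)
    (hT : IsThompsonSampling P v b r a s) (ht : 1 ≤ t) (i : Fin N) (l : ℝ) :
    CondMeanLEOne (P.restrict (a t ⁻¹' {i})) (info b r a t) fun ω ↦ ENNReal.ofReal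
      (Real.exp (l * (r t i ω - inner ℝ (b t i ω) μ) - l ^ 2 * R ^ 2 / 2)) := by
  have hreward : Measurable fun ω i ↦ r t i ω :=
    measurable_pi_lambda _ fun i ↦ hB.measurable_reward t ht i
  refine CondMeanLEOne.restrict_of_condIndep
    (m' := MeasurableSpace.comap (fun ω i ↦ r t i ω) inferInstance) (hB.info_le ht)
    hreward.comap_le (hB.measurable_arm t ht (measurableSet_singleton i)) ?_ ?_
    (hB.condMeanLEOne_exp_noise ht i l)
  · rintro _ ⟨S, hS, rfl⟩
    have hpreimage : (fun ω ↦ (s t ω, a t ω)) ⁻¹' (Set.univ ×ˢ {i}) = a t ⁻¹' {i} := by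
      ext ω
      simp
    simpa only [hpreimage] using hT.choice_condIndep t ht (Set.univ ×ˢ {i}) S
      (MeasurableSet.univ.prod (measurableSet_singleton i)) hS
  · have hrewards : Measurable[info b r a t ⊔
        MeasurableSpace.comap (fun ω i ↦ r t i ω) inferInstance] fun ω i ↦ r t i ω :=
      measurable_iff_comap_le.mpr le_sup_right
    have hr : Measurable[info b r a t ⊔ MeasurableSpace.comap (fun ω i ↦ r t i ω) inferInstance]
        (r t i) := (measurable_pi_apply i).comp hrewards
    have hb : Measurable[info b r a t ⊔ MeasurableSpace.comap (fun ω i ↦ r t i ω) inferInstance]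
        (b t i) := (measurable_context_info i).mono le_sup_left le_rfl
    exact (((hr.sub hb.inner_const).const_mul l).sub_const _).exp.ennreal_ofReal

lemma condMeanLEOne_exp_selfNormIncrement (hR : R ≠ 0) (hB : IsLinearBandit P R μ b r a)
    (hT : IsThompsonSampling P v b r a s) (ht : 1 ≤ t) :
    CondMeanLEOne P (info b r a t)
      fun ω ↦ ENNReal.ofReal (Real.exp (selfNormIncrement R μ b r a t ω)) := by
  simp only [exp_selfNormIncrement ht, playedNoise]
  refine CondMeanLEOne.of_countable_partition (k := a t)
    (f := fun i ω ↦ ENNReal.ofReal ((√(1 + width b a t i ω ^ 2))⁻¹ *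
      Real.exp ((2 * (r t i ω - inner ℝ (b t i ω) μ) * noiseDrift μ b r a t i ω +
        (r t i ω - inner ℝ (b t i ω) μ) ^ 2 * width b a t i ω ^ 2 -
        noiseDrift μ b r a t i ω ^ 2) / (1 + width b a t i ω ^ 2) / (2 * R ^ 2))))
    (fun i ↦ hB.measurable_arm t ht (measurableSet_singleton i)) fun i ↦ ?_
  exact CondMeanLEOne.gaussian_mixture (hB.info_le ht) hR
    ((hB.measurable_reward t ht i).sub (hB.measurable_context t ht i).inner_const)
    (condMeanLEOne_restrict_exp_noise hB hT ht i) (measurable_noiseDrift_info i)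
    ((measurable_width_info i).pow_const 2) fun ω ↦ sq_nonneg _

lemma measure_log_inv_lt_sum_info_le (hB : IsLinearBandit P R μ b r a) {n T : ℕ} (hn : 1 ≤ n)
    {ξ : ℕ → Ω → ℝ} (hξ : ∀ t ∈ Finset.Ico n T, Measurable[info b r a (t + 1)] (ξ t))
    (hc : ∀ t ∈ Finset.Ico n T,
      CondMeanLEOne P (info b r a t) fun ω ↦ ENNReal.ofReal (Real.exp (ξ t ω)))
    {ε : ℝ} (hε : 0 < ε) :
    P {ω | Real.log (1 / ε) < ∑ t ∈ Finset.Ico n T, ξ t ω} ≤ ENNReal.ofReal ε := by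
  refine measure_log_inv_lt_sum_le (monotone_info (b := b) (r := r) (a := a))
    (fun t ↦ hB.info_le (le_max_left 1 t)) (fun t ht ↦ ?_) (fun t ht ↦ ?_) hε
  · rw [max_eq_right (by omega)]
    exact hξ t ht
  · rw [max_eq_right (hn.trans (Finset.mem_Ico.mp ht).1)]
    exact hc t ht

lemma measure_lt_selfNormSq_le (hR : R ≠ 0) (hB : IsLinearBandit P R μ b r a)
    (hT : IsThompsonSampling P v b r a s) (ht : 1 ≤ t) {ε : ℝ} (hε : 0 < ε) :
    P {ω | R ^ 2 * (d * Real.log t + 2 * Real.log (1 / ε)) < selfNormSq μ b r a t ω} ≤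
      ENNReal.ofReal ε := by
  have hsum := measure_log_inv_lt_sum_info_le hB le_rfl (T := t) (ξ := selfNormIncrement R μ b r a)
    (fun τ hτ ↦ measurable_selfNormIncrement_info (Finset.mem_Ico.mp hτ).1)
    (fun τ hτ ↦ condMeanLEOne_exp_selfNormIncrement hR hB hT (Finset.mem_Ico.mp hτ).1) hε
  refine (measure_mono fun ω hω ↦ ?_).trans hsum
  rw [Set.mem_ofPred_eq, sum_selfNormIncrement ht]
  have hdet := log_det_designMatrix_le (a := a) hB.norm_context_le ht ω
  have hnorm : (d * Real.log t + 2 * Real.log (1 / ε)) / 2 <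
      selfNormSq μ b r a t ω / (2 * R ^ 2) := by
    rw [lt_div_iff₀ (by positivity)]
    linarith [hω.out]
  linarith

end SelfNormalized

/-! ### Unsaturated arms -/

section Unsaturated

variable {ι : Type*}

/-- The least value of `min ((g wᵢ)², 1)` over the unsaturated arms, those `i` whose gap is at most
`g wᵢ`, where `θ` are the mean rewards and `w` the widths of the arms. -/
def unsaturatedWidthSq (g : ℝ) (θ w : ι → ℝ) : ℝ :=
  ⨅ i, if (⨆ j, θ j) - θ i ≤ g * w i then min ((g * w i) ^ 2) 1 else 1

variable [Finite ι] {g c : ℝ} {θ w y : ι → ℝ}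

lemma unsaturatedWidthSq_le {i : ι} (hi : (⨆ j, θ j) - θ i ≤ g * w i) :
    unsaturatedWidthSq g θ w ≤ min ((g * w i) ^ 2) 1 :=
  (ciInf_le (Set.finite_range _).bddBelow i).trans_eq (if_pos hi)

lemma unsaturatedWidthSq_le_of_optimistic {k : ι} (hk : |y k - θ k| ≤ g * w k)
    (hopt : ⨆ j, θ j ≤ y k) : unsaturatedWidthSq g θ w ≤ min ((g * w k) ^ 2) 1 :=
  unsaturatedWidthSq_le (by linarith [le_abs_self (y k - θ k)])

variable [Nonempty ι]

lemma unsaturatedWidthSq_mem_Icc : unsaturatedWidthSq g θ w ∈ Set.Icc 0 1 := by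
  refine ⟨le_ciInf fun i ↦ ?_,
    (ciInf_le (Set.finite_range _).bddBelow (Classical.arbitrary ι)).trans ?_⟩ <;>
  split_ifs <;> simp [sq_nonneg]

lemma exists_unsaturatedWidthSq_eq (hg : 0 ≤ g) (hw : ∀ i, 0 ≤ w i) :
    ∃ i, (⨆ j, θ j) - θ i ≤ g * w i ∧ unsaturatedWidthSq g θ w = min ((g * w i) ^ 2) 1 := by
  obtain ⟨i, hi⟩ := exists_eq_ciInf_of_finite
    (f := fun i ↦ if (⨆ j, θ j) - θ i ≤ g * w i then min ((g * w i) ^ 2) 1 else 1)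
  change _ = unsaturatedWidthSq g θ w at hi
  by_cases hsat : (⨆ j, θ j) - θ i ≤ g * w i
  · exact ⟨i, hsat, by rw [← hi, if_pos hsat]⟩
  · rw [if_neg hsat] at hi
    obtain ⟨k, hk⟩ := exists_eq_ciSup_of_finite (f := θ)
    have hbest : (⨆ j, θ j) - θ k ≤ g * w k := by
      rw [← hk, sub_self]
      exact mul_nonneg hg (hw k)
    exact ⟨k, hbest, (unsaturatedWidthSq_le hbest).antisymm (hi ▸ min_le_right _ _)⟩

lemma gap_le_of_argmax (hg : 0 < g) (hc : 0 ≤ c) (hw : ∀ i, 0 ≤ w i) {k : ι}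
    (h : ∀ i, |y i - θ i| ≤ c * w i) (hk : ∀ i, y i ≤ y k) (hgap : (⨆ j, θ j) - θ k ≤ 1) :
    (⨆ j, θ j) - θ k ≤ (g + c) * (√(unsaturatedWidthSq g θ w) / g + w k) := by
  obtain ⟨i, hi, hwidth⟩ := exists_unsaturatedWidthSq_eq (θ := θ) hg.le hw
  rw [hwidth]
  rcases le_total ((g * w i) ^ 2) 1 with htrunc | htrunc
  · rw [min_eq_left htrunc, Real.sqrt_sq (mul_nonneg hg.le (hw i)),
      mul_div_cancel_left₀ _ hg.ne']
    have hθi := neg_abs_le (y i - θ i)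
    have hθk := le_abs_self (y k - θ k)
    have hgk := mul_nonneg hg.le (hw k)
    linarith [h i, h k, hk i]
  · rw [min_eq_right htrunc, Real.sqrt_one]
    calc (⨆ j, θ j) - θ k ≤ g * (1 / g) := by rwa [mul_one_div_cancel hg.ne']
      _ ≤ (g + c) * (1 / g + w k) := by
        have := hw k
        gcongr <;> linarith

end Unsaturated

/-! ### Confidence, optimism and the gap of the arm played -/

section Sampling

open Matrix

variable {Ω : Type*} {d N : ℕ}

/-- The event that the confidence ellipsoid of round `t`, scaled by `κ v_t`, contains `μ`. -/
def confident (κ : ℝ) (v : ℕ → ℝ) (μ : Vec d) (b : ℕ → Fin N → Ω → Vec d)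
    (r : ℕ → Fin N → Ω → ℝ) (a : ℕ → Ω → Fin N) (t : ℕ) : Set Ω :=
  {ω | √(selfNormSq μ b r a t ω) + 1 ≤ κ * v t}

/-- The least squared width of the unsaturated arms of round `t`, scaled by `g²` and truncated. -/
def exploration (g : ℝ) (μ : Vec d) (b : ℕ → Fin N → Ω → Vec d) (a : ℕ → Ω → Fin N) (t : ℕ)
    (ω : Ω) : ℝ :=
  unsaturatedWidthSq g (fun i ↦ inner ℝ (b t i ω) μ) (fun i ↦ width b a t i ω)

/-- The amount by which the gap of the arm played, measured in units of widths, exceeds `2 g`.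
It stands in for the deviation of the sample, which the history does not determine. -/
def excess (g : ℝ) (μ : Vec d) (b : ℕ → Fin N → Ω → Vec d) (a : ℕ → Ω → Fin N) (t : ℕ)
    (ω : Ω) : ℝ :=
  max 0 (gap μ b t (a t ω) ω /
    (√(exploration g μ b a t ω) / g + width b a t (a t ω) ω) - 2 * g)

/-- The covariance matrix of the sample of round `t`. -/
def sampleCov (v : ℕ → ℝ) (b : ℕ → Fin N → Ω → Vec d) (a : ℕ → Ω → Fin N) (t : ℕ) (ω : Ω) :
    Matrix (Fin d) (Fin d) ℝ :=
  v t ^ 2 • (designMatrix b a t ω)⁻¹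

/-- The largest squared standardized deviation of the sample `z.2` in round `t`. -/
def sampleDevSq (v : ℕ → ℝ) (b : ℕ → Fin N → Ω → Vec d) (r : ℕ → Fin N → Ω → ℝ)
    (a : ℕ → Ω → Fin N) (t : ℕ) (z : Ω × Vec d) : ℝ :=
  maxDevSq (fun i ↦ b t i z.1) (estimate b r a t z.1) (sampleCov v b a t z.1) z.2

/-- The samples of round `t` that are optimistic for the current contexts and estimate. -/
def optimistic (M : ℝ) (v : ℕ → ℝ) (μ : Vec d) (b : ℕ → Fin N → Ω → Vec d)
    (r : ℕ → Fin N → Ω → ℝ) (a : ℕ → Ω → Fin N) (t : ℕ) : Set (Ω × Vec d) :=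
  {z | z.2 ∈ optimisticSet (fun i ↦ b t i z.1) (estimate b r a t z.1) μ (sampleCov v b a t z.1) M}

variable {R κ g M q : ℝ} {μ : Vec d} {v : ℕ → ℝ} {b : ℕ → Fin N → Ω → Vec d}
  {r : ℕ → Fin N → Ω → ℝ} {a : ℕ → Ω → Fin N} {s : ℕ → Ω → Vec d} {t : ℕ} {ω : Ω}

lemma posDef_sampleCov (hv : 0 < v t) (ω : Ω) : (sampleCov v b a t ω).PosDef :=
  (posDef_designMatrix t ω).inv.smul (pow_pos hv 2)

lemma dotProduct_sampleCov (i : Fin N) (ω : Ω) :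
    (b t i ω).ofLp ⬝ᵥ sampleCov v b a t ω *ᵥ (b t i ω).ofLp = (v t * width b a t i ω) ^ 2 := by
  rw [sampleCov, smul_mulVec, dotProduct_smul, smul_eq_mul, mul_pow, sq_width]

lemma sqrt_dotProduct_sampleCov (hv : 0 < v t) (i : Fin N) (ω : Ω) :
    √((b t i ω).ofLp ⬝ᵥ sampleCov v b a t ω *ᵥ (b t i ω).ofLp) = v t * width b a t i ω := by
  rw [dotProduct_sampleCov, Real.sqrt_sq (mul_nonneg hv.le (width_nonneg t i ω))]

lemma sampleDevSq_nonneg (hv : 0 < v t) (z : Ω × Vec d) : 0 ≤ sampleDevSq v b r a t z :=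
  maxDevSq_nonneg (posDef_sampleCov hv _).posSemidef _ _ _

lemma exploration_mem_Icc [Nonempty (Fin N)] (ω : Ω) : exploration g μ b a t ω ∈ Set.Icc 0 1 :=
  unsaturatedWidthSq_mem_Icc

lemma excess_nonneg (ω : Ω) : 0 ≤ excess g μ b a t ω := le_max_left _ _

section Confident

variable (hω : ω ∈ confident κ v μ b r a t)
include hω

lemma abs_inner_estimate_sub_le_of_confident (hμ : ‖μ‖ ≤ 1) (i : Fin N) :
    |inner ℝ (b t i ω) (estimate b r a t ω) - inner ℝ (b t i ω) μ| ≤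
      κ * (v t * width b a t i ω) := by
  refine (abs_inner_estimate_sub_le hμ t i ω).trans ?_
  rw [← mul_assoc, mul_comm]
  exact mul_le_mul_of_nonneg_right hω (width_nonneg t i ω)

lemma abs_inner_sub_le_of_confident (hμ : ‖μ‖ ≤ 1) (hv : 0 < v t) (i : Fin N) (x : Vec d) :
    |inner ℝ (b t i ω) x - inner ℝ (b t i ω) μ| ≤
      (√(sampleDevSq v b r a t (ω, x)) + κ) * v t * width b a t i ω := by
  have hsample := abs_inner_sub_le_sqrt_maxDevSq_mul (posDef_sampleCov (b := b) (a := a) hv ω)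
    (fun i ↦ b t i ω) x (estimate b r a t ω) i
  rw [sqrt_dotProduct_sampleCov hv] at hsample
  calc |inner ℝ (b t i ω) x - inner ℝ (b t i ω) μ|
      ≤ _ := abs_sub_le _ (inner ℝ (b t i ω) (estimate b r a t ω)) _
    _ ≤ _ := add_le_add hsample (abs_inner_estimate_sub_le_of_confident hω hμ i)
    _ = _ := by rw [sampleDevSq]; ring

lemma le_measureReal_optimistic (hN : 2 ≤ N) (hμ : ‖μ‖ ≤ 1) (hv : 0 < v t)
    (hM : Real.exp (3 / 2 * min (d : ℝ) (Real.log N) - M / 4) ≤ q)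
    (hq : 2 * q ≤ (gaussianReal 0 1).real (Set.Ici κ)) :
    q ≤ (multivariateGaussian (estimate b r a t ω) (sampleCov v b a t ω)).real
      {x | (ω, x) ∈ optimistic M v μ b r a t} := by
  have hS := posDef_sampleCov (b := b) (a := a) hv ω
  have hconf (i : Fin N) : |inner ℝ (b t i ω) (estimate b r a t ω) - inner ℝ (b t i ω) μ| ≤
      κ * √((b t i ω).ofLp ⬝ᵥ sampleCov v b a t ω *ᵥ (b t i ω).ofLp) := by
    rw [sqrt_dotProduct_sampleCov hv]
    exact abs_inner_estimate_sub_le_of_confident hω hμ i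
  have hcard : Real.exp (3 / 2 * min (Fintype.card (Fin d) : ℝ)
      (Real.log (Fintype.card (Fin N))) - M / 4) ≤ q := by simpa only [Fintype.card_fin] using hM
  have hsection : {x | (ω, x) ∈ optimistic M v μ b r a t} =
      optimisticSet (fun i ↦ b t i ω) (estimate b r a t ω) μ (sampleCov v b a t ω) M := rfl
  rw [hsection]
  exact le_measureReal_optimisticSet hS.posSemidef (by simpa only [Fintype.card_fin] using hN)
    hconf hcard hq

variable [MeasurableSpace Ω] {P : Measure Ω} (hB : IsLinearBandit P R μ b r a)
  (hT : IsThompsonSampling P v b r a s) (ht : 1 ≤ t) (hv : 0 < v t)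
include hB hT ht hv

lemma exploration_le_of_optimistic (hg : (√M + κ) * v t ≤ g)
    (hopt : (ω, s t ω) ∈ optimistic M v μ b r a t) :
    exploration g μ b a t ω ≤ min ((g * width b a t (a t ω) ω) ^ 2) 1 := by
  have : Nonempty (Fin N) := ⟨a t ω⟩
  have hdev : √(sampleDevSq v b r a t (ω, s t ω)) ≤ √M := Real.sqrt_le_sqrt hopt.2
  refine unsaturatedWidthSq_le_of_optimistic (y := fun i ↦ inner ℝ (b t i ω) (s t ω)) ?_
    (hopt.1.trans (ciSup_le (hT.arm_argmax t ht ω)))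
  calc _ ≤ (√(sampleDevSq v b r a t (ω, s t ω)) + κ) * v t * width b a t (a t ω) ω :=
        abs_inner_sub_le_of_confident hω hB.norm_param_le hv _ _
    _ ≤ g * width b a t (a t ω) ω :=
        mul_le_mul_of_nonneg_right (le_trans (by gcongr) hg) (width_nonneg t _ ω)

variable (hg : 0 < g) (hκ : 0 ≤ κ) (hκg : κ * v t ≤ g)
include hg hκ hκg

lemma gap_le_sampleDevSq_mul :
    gap μ b t (a t ω) ω ≤ (2 * g + √(sampleDevSq v b r a t (ω, s t ω)) * v t) *
      (√(exploration g μ b a t ω) / g + width b a t (a t ω) ω) := by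
  have : Nonempty (Fin N) := ⟨a t ω⟩
  have hwidth := width_nonneg (b := b) (a := a) t (a t ω) ω
  calc gap μ b t (a t ω) ω
      ≤ (g + (√(sampleDevSq v b r a t (ω, s t ω)) + κ) * v t) *
        (√(exploration g μ b a t ω) / g + width b a t (a t ω) ω) :=
        gap_le_of_argmax hg (by positivity) (fun i ↦ width_nonneg t i ω)
          (fun i ↦ abs_inner_sub_le_of_confident hω hB.norm_param_le hv i (s t ω))
          (hT.arm_argmax t ht ω) (hB.gap_le t ht _ ω)
    _ ≤ _ := mul_le_mul_of_nonneg_right (by linarith) (by positivity)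

lemma sq_excess_le : excess g μ b a t ω ^ 2 ≤ sampleDevSq v b r a t (ω, s t ω) * v t ^ 2 := by
  have hwidth := width_nonneg (b := b) (a := a) t (a t ω) ω
  have hle : excess g μ b a t ω ≤ √(sampleDevSq v b r a t (ω, s t ω)) * v t := by
    refine max_le (by positivity) (sub_le_iff_le_add'.mpr ?_)
    exact div_le_of_le_mul₀ (by positivity) (by positivity)
      (gap_le_sampleDevSq_mul hω hB hT ht hv hg hκ hκg)
  calc excess g μ b a t ω ^ 2 ≤ (√(sampleDevSq v b r a t (ω, s t ω)) * v t) ^ 2 :=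
        pow_le_pow_left₀ (excess_nonneg ω) hle 2
    _ = _ := by rw [mul_pow, Real.sq_sqrt (sampleDevSq_nonneg hv _)]

lemma gap_le_excess_mul :
    gap μ b t (a t ω) ω ≤ (2 * g + excess g μ b a t ω) *
      (√(exploration g μ b a t ω) / g + width b a t (a t ω) ω) := by
  have hwidth := width_nonneg (b := b) (a := a) t (a t ω) ω
  have hnonneg : 0 ≤ √(exploration g μ b a t ω) / g + width b a t (a t ω) ω := by positivity
  rcases hnonneg.eq_or_lt with hzero | hpos
  · simpa only [← hzero, mul_zero] using gap_le_sampleDevSq_mul hω hB hT ht hv hg hκ hκg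
  · rw [← div_le_iff₀ hpos, ← sub_le_iff_le_add']
    exact le_max_right _ _

end Confident

lemma measurableSet_confident_info : MeasurableSet[info b r a t] (confident κ v μ b r a t) :=
  measurableSet_le (measurable_selfNormSq_info.sqrt.add_const 1) measurable_const

lemma measurable_exploration_info : Measurable[info b r a t] (exploration g μ b a t) := by
  have hwidth (i : Fin N) : Measurable[info b r a t] fun ω ↦ g * width b a t i ω :=
    (measurable_width_info i).const_mul g
  exact Measurable.iInf fun i ↦ Measurable.ite (measurableSet_le (measurable_gap_info i) (hwidth i))
    (((hwidth i).pow_const 2).min measurable_const) measurable_const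

lemma measurable_playedWidth_info_succ (ht : 1 ≤ t) :
    Measurable[info b r a (t + 1)] fun ω ↦ width b a t (a t ω) ω :=
  measurable_apply_index (fun i ↦ (measurable_width_info i).mono (info_le_info_succ ht) le_rfl)
    (measurable_arm_info (Finset.mem_Ico.mpr ⟨ht, t.lt_succ_self⟩))

lemma measurable_excess_info_succ (ht : 1 ≤ t) :
    Measurable[info b r a (t + 1)] (excess g μ b a t) := by
  have hgap : Measurable[info b r a (t + 1)] fun ω ↦ gap μ b t (a t ω) ω :=
    measurable_apply_index (fun i ↦ (measurable_gap_info i).mono (info_le_info_succ ht) le_rfl)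
      (measurable_arm_info (Finset.mem_Ico.mpr ⟨ht, t.lt_succ_self⟩))
  have hexploration : Measurable[info b r a (t + 1)] (exploration g μ b a t) :=
    measurable_exploration_info.mono (info_le_info_succ ht) le_rfl
  exact measurable_const.max ((hgap.div ((hexploration.sqrt.div_const g).add
    (measurable_playedWidth_info_succ ht))).sub_const _)

lemma measurable_sampleDevSq :
    Measurable[(info b r a t).prod inferInstance] (sampleDevSq v b r a t) := by
  refine Measurable.iSup fun i ↦ ?_
  simp only [dotProduct_sampleCov]
  have hcontext : Measurable[(info b r a t).prod inferInstance] fun z : Ω × Vec d ↦ b t i z.1 :=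
    (measurable_context_info i).comp measurable_fst
  have hestimate : Measurable[(info b r a t).prod inferInstance]
      fun z : Ω × Vec d ↦ estimate b r a t z.1 := measurable_estimate_info.comp measurable_fst
  have hwidth : Measurable[(info b r a t).prod inferInstance]
      fun z : Ω × Vec d ↦ width b a t i z.1 := (measurable_width_info i).comp measurable_fst
  exact (((hcontext.inner measurable_snd).sub (hcontext.inner hestimate)).pow_const 2).div
    ((hwidth.const_mul _).pow_const 2)

lemma measurableSet_optimistic :
    MeasurableSet[(info b r a t).prod inferInstance] (optimistic M v μ b r a t) := by
  have hcontext (i : Fin N) : Measurable[(info b r a t).prod inferInstance]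
      fun z : Ω × Vec d ↦ b t i z.1 := (measurable_context_info i).comp measurable_fst
  have hparam (i : Fin N) : Measurable[(info b r a t).prod inferInstance]
      fun z : Ω × Vec d ↦ inner ℝ (b t i z.1) μ := (hcontext i).inner measurable_const
  have hsample (i : Fin N) : Measurable[(info b r a t).prod inferInstance]
      fun z : Ω × Vec d ↦ inner ℝ (b t i z.1) z.2 := (hcontext i).inner measurable_snd
  exact (measurableSet_le (Measurable.iSup hparam) (Measurable.iSup hsample)).inter
    (measurableSet_le measurable_sampleDevSq measurable_const)

end Sampling

/-! ### Exponential supermartingale increments -/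

section ExponentialIndicator

open scoped ENNReal

lemma half_le_one_sub_exp_neg {x : ℝ} (h0 : 0 ≤ x) (h1 : x ≤ 1) :
    x / 2 ≤ 1 - Real.exp (-x) := by
  have hexp : Real.exp (-x) ≤ (1 + x)⁻¹ := by
    rw [Real.exp_neg]
    exact inv_anti₀ (by linarith) (by linarith [Real.add_one_le_exp x])
  have hinv : (1 + x)⁻¹ ≤ 1 - x / 2 := by
    rw [inv_le_iff_one_le_mul₀ (by linarith)]
    nlinarith
  linarith

lemma integral_exp_sub_indicator_le_one {E : Type*} [MeasurableSpace E] {ν : Measure E}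
    [IsProbabilityMeasure ν] {O : Set E} (hO : MeasurableSet O) {q x : ℝ} (hq : q ≤ ν.real O)
    (h0 : 0 ≤ x) (h1 : x ≤ 1) :
    ∫ z, Real.exp (q * x / 2) * (1 - O.indicator (fun _ ↦ 1 - Real.exp (-x)) z) ∂ν ≤ 1 := by
  have hmul : q * x / 2 ≤ ν.real O * (1 - Real.exp (-x)) :=
    calc q * x / 2 = q * (x / 2) := by ring
      _ ≤ ν.real O * (1 - Real.exp (-x)) :=
        mul_le_mul hq (half_le_one_sub_exp_neg h0 h1) (by positivity) measureReal_nonneg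
  rw [integral_const_mul, integral_sub (integrable_const _) ((integrable_const _).indicator hO),
    integral_indicator_const _ hO]
  simp only [integral_const, probReal_univ, smul_eq_mul, one_mul]
  calc Real.exp (q * x / 2) * (1 - ν.real O * (1 - Real.exp (-x)))
      ≤ Real.exp (q * x / 2) * Real.exp (-(q * x / 2)) := by
        gcongr
        linarith [Real.add_one_le_exp (-(q * x / 2))]
    _ = 1 := by rw [← Real.exp_add, add_neg_cancel, Real.exp_zero]

lemma lintegral_exp_sub_indicator_le_one {E : Type*} [MeasurableSpace E] {ν : Measure E}
    [IsProbabilityMeasure ν] {O : Set E} (hO : MeasurableSet O) {q x : ℝ} (hq : q ≤ ν.real O)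
    (h0 : 0 ≤ x) (h1 : x ≤ 1) :
    ∫⁻ z, ENNReal.ofReal (Real.exp (q * x / 2 - O.indicator (fun _ ↦ x) z)) ∂ν ≤ 1 := by
  have hexp (z : E) : Real.exp (q * x / 2 - O.indicator (fun _ ↦ x) z) =
      Real.exp (q * x / 2) * (1 - O.indicator (fun _ ↦ 1 - Real.exp (-x)) z) := by
    by_cases hz : z ∈ O
    · rw [Set.indicator_of_mem hz, Set.indicator_of_mem hz, sub_sub_cancel, ← Real.exp_add,
        sub_eq_add_neg]
    · simp only [Set.indicator_of_notMem hz, sub_zero, mul_one]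
  rw [← ofReal_integral_eq_lintegral_ofReal _ (ae_of_all _ fun z ↦ (Real.exp_pos _).le)]
  · simpa only [hexp, ENNReal.ofReal_le_one] using integral_exp_sub_indicator_le_one hO hq h0 h1
  · simp only [hexp]
    exact ((integrable_const _).sub ((integrable_const _).indicator hO)).const_mul _

end ExponentialIndicator

section Increments

open scoped ENNReal

variable {Ω : Type*} {d N : ℕ} {κ g q : ℝ} {v : ℕ → ℝ} {μ : Vec d} {b : ℕ → Fin N → Ω → Vec d}
  {r : ℕ → Fin N → Ω → ℝ} {a : ℕ → Ω → Fin N} {s : ℕ → Ω → Vec d} {t : ℕ}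

/-- The logarithmic increment of the supermartingale that controls the sum of the squared
excesses; the constant `c` compensates for the mean of the squared sample deviation. -/
def excessIncrement (κ g c : ℝ) (v : ℕ → ℝ) (μ : Vec d) (b : ℕ → Fin N → Ω → Vec d)
    (r : ℕ → Fin N → Ω → ℝ) (a : ℕ → Ω → Fin N) (t : ℕ) (ω : Ω) : ℝ :=
  (confident κ v μ b r a t).indicator (fun ω ↦ excess g μ b a t ω ^ 2 / (4 * v t ^ 2)) ω - c

/-- The exploration of round `t`, set to zero where the confidence event fails. -/
def confidentExploration (κ g : ℝ) (v : ℕ → ℝ) (μ : Vec d) (b : ℕ → Fin N → Ω → Vec d)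
    (r : ℕ → Fin N → Ω → ℝ) (a : ℕ → Ω → Fin N) (t : ℕ) : Ω → ℝ :=
  (confident κ v μ b r a t).indicator (exploration g μ b a t)

/-- The logarithmic increment of the supermartingale that compares the exploration with the
squared widths of the arms played; `q` is a lower bound for the probability of optimism. -/
def explorationIncrement (κ g q : ℝ) (v : ℕ → ℝ) (μ : Vec d) (b : ℕ → Fin N → Ω → Vec d)
    (r : ℕ → Fin N → Ω → ℝ) (a : ℕ → Ω → Fin N) (t : ℕ) (ω : Ω) : ℝ :=
  q * confidentExploration κ g v μ b r a t ω / 2 - min ((g * width b a t (a t ω) ω) ^ 2) 1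

lemma confidentExploration_mem_Icc [Nonempty (Fin N)] (ω : Ω) :
    confidentExploration κ g v μ b r a t ω ∈ Set.Icc 0 1 :=
  ⟨Set.indicator_apply_nonneg fun _ ↦ (exploration_mem_Icc ω).1,
    Set.indicator_apply_le' (fun _ ↦ (exploration_mem_Icc ω).2) fun _ ↦ zero_le_one⟩

lemma measurable_confidentExploration_info :
    Measurable[info b r a t] (confidentExploration κ g v μ b r a t) :=
  measurable_exploration_info.indicator measurableSet_confident_info

lemma measurable_excessIncrement (ht : 1 ≤ t) (c : ℝ) :
    Measurable[info b r a (t + 1)] (excessIncrement κ g c v μ b r a t) :=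
  ((((measurable_excess_info_succ ht).pow_const 2).div_const _).indicator
    (info_le_info_succ ht _ measurableSet_confident_info)).sub_const c

lemma measurable_explorationIncrement (ht : 1 ≤ t) :
    Measurable[info b r a (t + 1)] (explorationIncrement κ g q v μ b r a t) := by
  have hexploration : Measurable[info b r a (t + 1)] (confidentExploration κ g v μ b r a t) :=
    measurable_confidentExploration_info.mono (info_le_info_succ ht) le_rfl
  exact ((hexploration.const_mul q).div_const 2).sub
    ((((measurable_playedWidth_info_succ ht).const_mul g).pow_const 2).min measurable_const)

variable [MeasurableSpace Ω] {P : Measure Ω} {R M : ℝ} (hB : IsLinearBandit P R μ b r a)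
  (hT : IsThompsonSampling P v b r a s) (ht : 1 ≤ t)
include hB hT ht

lemma condMeanLEOne_sample [IsFiniteMeasure P] {F : Ω × Vec d → ℝ≥0∞}
    (hF : Measurable[(info b r a t).prod inferInstance] F)
    (hmean : ∀ ω, ∫⁻ x, F (ω, x)
      ∂(multivariateGaussian (estimate b r a t ω) (sampleCov v b a t ω)) ≤ 1) :
    CondMeanLEOne P (info b r a t) fun ω ↦ F (ω, s t ω) :=
  .of_condLaw (hB.info_le ht) (hT.measurable_sample t ht) (hT.sample_law t ht) hF hmean

variable (hv : 0 < v t)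
include hv

lemma confidentExploration_le_of_optimistic (hg : (√M + κ) * v t ≤ g) {ω : Ω}
    (hopt : (ω, s t ω) ∈ optimistic M v μ b r a t) :
    confidentExploration κ g v μ b r a t ω ≤ min ((g * width b a t (a t ω) ω) ^ 2) 1 :=
  Set.indicator_apply_le' (fun hω ↦ exploration_le_of_optimistic hω hB hT ht hv hg hopt)
    fun _ ↦ by positivity

variable (hN : 2 ≤ N)
include hN

lemma condMeanLEOne_exp_sampleDevSq [IsFiniteMeasure P] :
    CondMeanLEOne P (info b r a t) fun ω ↦ ENNReal.ofReal (Real.exp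
      (sampleDevSq v b r a t (ω, s t ω) / 4 - 3 / 2 * min (d : ℝ) (Real.log N))) := by
  refine condMeanLEOne_sample hB hT ht (F := fun z ↦ ENNReal.ofReal (Real.exp
    (sampleDevSq v b r a t z / 4 - 3 / 2 * min (d : ℝ) (Real.log N))))
    ((measurable_sampleDevSq.div_const 4).sub_const _).exp.ennreal_ofReal fun ω ↦ ?_
  have hexp := lintegral_exp_maxDevSq_le (posDef_sampleCov (b := b) (a := a) hv ω).posSemidef
    (by simpa only [Fintype.card_fin] using hN) (fun i ↦ b t i ω) (estimate b r a t ω)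
  simp only [Fintype.card_fin] at hexp
  simp only [Real.exp_sub, ENNReal.ofReal_div_of_pos (Real.exp_pos _),
    ENNReal.div_eq_inv_mul]
  rw [lintegral_const_mul' _ _ (by simp [Real.exp_pos]), ← ENNReal.div_eq_inv_mul]
  exact ENNReal.div_le_of_le_mul (hexp.trans_eq (one_mul _).symm)

lemma condMeanLEOne_exp_excessIncrement [IsFiniteMeasure P] (hg : 0 < g) (hκ : 0 ≤ κ)
    (hκg : κ * v t ≤ g) :
    CondMeanLEOne P (info b r a t) fun ω ↦ ENNReal.ofReal (Real.exp
      (excessIncrement κ g (3 / 2 * min (d : ℝ) (Real.log N)) v μ b r a t ω)) := by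
  refine (condMeanLEOne_exp_sampleDevSq hB hT ht hv hN).mono fun ω ↦
    ENNReal.ofReal_le_ofReal <| Real.exp_le_exp.mpr <| sub_le_sub_right ?_ _
  have hdev := sampleDevSq_nonneg (b := b) (r := r) (a := a) hv (ω, s t ω)
  refine Set.indicator_apply_le' (fun hω ↦ ?_) fun _ ↦ by positivity
  rw [div_le_div_iff₀ (by positivity) (by norm_num)]
  linarith [sq_excess_le hω hB hT ht hv hg hκ hκg]

lemma condMeanLEOne_exp_explorationIncrement [IsFiniteMeasure P] (hg : (√M + κ) * v t ≤ g)
    (hM : Real.exp (3 / 2 * min (d : ℝ) (Real.log N) - M / 4) ≤ q)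
    (hq : 2 * q ≤ (gaussianReal 0 1).real (Set.Ici κ)) :
    CondMeanLEOne P (info b r a t) fun ω ↦ ENNReal.ofReal (Real.exp
      (explorationIncrement κ g q v μ b r a t ω)) := by
  have : Nonempty (Fin N) := ⟨⟨0, by omega⟩⟩
  let X := confidentExploration κ g v μ b r a t
  let O := optimistic M v μ b r a t
  have hX : Measurable[(info b r a t).prod inferInstance] fun z : Ω × Vec d ↦ X z.1 :=
    measurable_confidentExploration_info.comp measurable_fst
  refine (condMeanLEOne_sample hB hT ht (F := fun z ↦ ENNReal.ofReal (Real.exp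
    (q * X z.1 / 2 - O.indicator (fun z ↦ X z.1) z))) ?_ fun ω ↦ ?_).mono fun ω ↦ ?_
  · exact (((hX.const_mul q).div_const 2).sub
      (hX.indicator measurableSet_optimistic)).exp.ennreal_ofReal
  · by_cases hω : ω ∈ confident κ v μ b r a t
    · exact lintegral_exp_sub_indicator_le_one
        (measurableSet_optimistic.preimage measurable_prodMk_left)
        (le_measureReal_optimistic hω hN hB.norm_param_le hv hM hq)
        (confidentExploration_mem_Icc ω).1 (confidentExploration_mem_Icc ω).2
    · have hzero : X ω = 0 := Set.indicator_of_notMem hω _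
      have hindicator (x : Vec d) : O.indicator (fun z ↦ X z.1) (ω, x) = 0 :=
        Set.indicator_apply_eq_zero.mpr fun _ ↦ hzero
      simp [hzero, hindicator]
  · refine ENNReal.ofReal_le_ofReal <| Real.exp_le_exp.mpr <| sub_le_sub_left ?_ _
    exact Set.indicator_apply_le' (confidentExploration_le_of_optimistic hB hT ht hv hg)
      fun _ ↦ by positivity

end Increments

/-! ### The regret on the good event -/

section Good

/-- The event that the confidence ellipsoids of rounds `2, …, T` contain `μ` and neither of the
two exponential supermartingales exceeds `exp L`. Round `1` is left out because the confidence
level of round `t` is of order `log t`. -/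
def good {Ω : Type*} {d N : ℕ} (κ g c q L : ℝ) (v : ℕ → ℝ) (μ : Vec d)
    (b : ℕ → Fin N → Ω → Vec d) (r : ℕ → Fin N → Ω → ℝ) (a : ℕ → Ω → Fin N) (T : ℕ) : Set Ω :=
  {ω | (∀ t ∈ Finset.Ico 2 (T + 1), ω ∈ confident κ v μ b r a t) ∧
    ∑ t ∈ Finset.Ico 2 (T + 1), excessIncrement κ g c v μ b r a t ω ≤ L ∧
    ∑ t ∈ Finset.Ico 2 (T + 1), explorationIncrement κ g q v μ b r a t ω ≤ L}

lemma log_le_two_mul_log {x y : ℝ} (hx : 0 < x) (hxy : x ≤ y ^ 2) :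
    Real.log x ≤ 2 * Real.log y := by
  simpa only [Real.log_pow, Nat.cast_ofNat] using Real.log_le_log hx hxy

lemma sum_sq_add_le (I : Finset ℕ) (y z : ℕ → ℝ) :
    ∑ t ∈ I, (y t + z t) ^ 2 ≤ 2 * ∑ t ∈ I, y t ^ 2 + 2 * ∑ t ∈ I, z t ^ 2 := by
  rw [← mul_add, ← Finset.sum_add_distrib, Finset.mul_sum]
  exact Finset.sum_le_sum fun t _ ↦ add_sq_le

lemma sum_mul_le_sqrt_mul_sqrt_of_nonneg {I : Finset ℕ} {g : ℝ} {y x w : ℕ → ℝ}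
    (hx : ∀ t ∈ I, 0 ≤ x t) :
    ∑ t ∈ I, (2 * g + y t) * (√(x t) / g + w t) ≤
      √(8 * g ^ 2 * I.card + 2 * ∑ t ∈ I, y t ^ 2) *
        √(2 * (∑ t ∈ I, x t) / g ^ 2 + 2 * ∑ t ∈ I, w t ^ 2) := by
  have hleft : ∑ t ∈ I, (2 * g + y t) ^ 2 ≤ 8 * g ^ 2 * I.card + 2 * ∑ t ∈ I, y t ^ 2 := by
    refine (sum_sq_add_le I _ y).trans_eq ?_
    rw [Finset.sum_const, nsmul_eq_mul]
    ring
  have hright : ∑ t ∈ I, (√(x t) / g + w t) ^ 2 ≤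
      2 * (∑ t ∈ I, x t) / g ^ 2 + 2 * ∑ t ∈ I, w t ^ 2 := by
    refine (sum_sq_add_le I _ w).trans_eq ?_
    rw [mul_div_assoc, Finset.sum_div]
    congr 2
    exact Finset.sum_congr rfl fun t ht ↦ by rw [div_pow, Real.sq_sqrt (hx t ht)]
  exact (Real.sum_mul_le_sqrt_mul_sqrt I _ _).trans (by gcongr)

variable {Ω : Type*} {d N T : ℕ} {R κ g c q L V : ℝ} {μ : Vec d} {v : ℕ → ℝ}
  {b : ℕ → Fin N → Ω → Vec d} {r : ℕ → Fin N → Ω → ℝ} {a : ℕ → Ω → Fin N} {s : ℕ → Ω → Vec d}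
  {ω : Ω}

lemma sum_sq_playedWidth_le (hb : ∀ t, 1 ≤ t → ∀ i ω, ‖b t i ω‖ ≤ 1) (hT : 2 ≤ T) :
    ∑ t ∈ Finset.Ico 2 (T + 1), width b a t (a t ω) ω ^ 2 ≤ 4 * (d * Real.log T) := by
  have hlog : Real.log (T + 1) ≤ 2 * Real.log T :=
    log_le_two_mul_log (by positivity) (by exact_mod_cast (by nlinarith : T + 1 ≤ T ^ 2))
  calc ∑ t ∈ Finset.Ico 2 (T + 1), width b a t (a t ω) ω ^ 2
      ≤ ∑ t ∈ Finset.Icc 1 T, width b a t (a t ω) ω ^ 2 :=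
        Finset.sum_le_sum_of_subset_of_nonneg
          (fun t ht ↦ by simp only [Finset.mem_Ico, Finset.mem_Icc] at ht ⊢; omega)
          fun _ _ _ ↦ sq_nonneg _
    _ ≤ 2 * (d * Real.log (T + 1)) := sum_sq_width_le hb T ω
    _ ≤ 2 * (d * (2 * Real.log T)) := by gcongr
    _ = 4 * (d * Real.log T) := by ring

lemma sum_sq_excess_le_of_mem_good (hω : ω ∈ good κ g c q L v μ b r a T) (hT : 2 ≤ T)
    (hc : 0 ≤ c) (hv : ∀ t ∈ Finset.Ico 2 (T + 1), 0 < v t)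
    (hV : ∀ t ∈ Finset.Ico 2 (T + 1), v t ≤ V) :
    ∑ t ∈ Finset.Ico 2 (T + 1), excess g μ b a t ω ^ 2 ≤ 4 * V ^ 2 * (c * T + L) := by
  have htwo : 2 ∈ Finset.Ico 2 (T + 1) := Finset.mem_Ico.mpr ⟨le_rfl, by omega⟩
  have hVpos : 0 < V := (hv 2 htwo).trans_le (hV 2 htwo)
  have hcard : ((Finset.Ico 2 (T + 1)).card : ℝ) * c ≤ T * c :=
    mul_le_mul_of_nonneg_right (by rw [Nat.card_Ico]; exact_mod_cast (by omega)) hc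
  have hincrement (t : ℕ) (ht : t ∈ Finset.Ico 2 (T + 1)) :
      excess g μ b a t ω ^ 2 / (4 * V ^ 2) - c ≤ excessIncrement κ g c v μ b r a t ω := by
    rw [excessIncrement, Set.indicator_of_mem (hω.1 t ht)]
    have hvt := hv t ht
    gcongr
    exact hV t ht
  have hsum := (Finset.sum_le_sum hincrement).trans hω.2.1
  rw [Finset.sum_sub_distrib, ← Finset.sum_div, Finset.sum_const, nsmul_eq_mul] at hsum
  rw [← div_le_iff₀' (by positivity)]
  linarith

lemma sum_exploration_le_of_mem_good (hω : ω ∈ good κ g c q L v μ b r a T) (hq : 0 < q) :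
    ∑ t ∈ Finset.Ico 2 (T + 1), exploration g μ b a t ω ≤
      2 / q * (g ^ 2 * ∑ t ∈ Finset.Ico 2 (T + 1), width b a t (a t ω) ω ^ 2 + L) := by
  have hincrement (t : ℕ) (ht : t ∈ Finset.Ico 2 (T + 1)) :
      q / 2 * exploration g μ b a t ω - g ^ 2 * width b a t (a t ω) ω ^ 2 ≤
        explorationIncrement κ g q v μ b r a t ω := by
    rw [explorationIncrement, confidentExploration, Set.indicator_of_mem (hω.1 t ht), ← mul_pow]
    linarith [min_le_left ((g * width b a t (a t ω) ω) ^ 2) 1]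
  have hsum := (Finset.sum_le_sum hincrement).trans hω.2.2
  rw [Finset.sum_sub_distrib, ← Finset.mul_sum, ← Finset.mul_sum] at hsum
  rw [div_mul_eq_mul_div, le_div_iff₀ hq]
  linarith

variable [MeasurableSpace Ω] {P : Measure Ω}

lemma regret_le_one_add (hB : IsLinearBandit P R μ b r a) (hT : 1 ≤ T) :
    regret μ b a T ω ≤ 1 + ∑ t ∈ Finset.Ico 2 (T + 1), gap μ b t (a t ω) ω := by
  rw [regret, ← Finset.Ico_add_one_right_eq_Icc,
    Finset.sum_eq_sum_Ico_succ_bot (by omega : 1 < T + 1)]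
  exact add_le_add_left (hB.gap_le 1 le_rfl _ ω) _

lemma regret_le_of_mem_good (hω : ω ∈ good κ g c q L v μ b r a T)
    (hB : IsLinearBandit P R μ b r a) (hTS : IsThompsonSampling P v b r a s) (hT : 2 ≤ T)
    (hg : 0 < g) (hκ : 0 ≤ κ) (hc : 0 ≤ c) (hq : 0 < q)
    (hv : ∀ t ∈ Finset.Ico 2 (T + 1), 0 < v t) (hV : ∀ t ∈ Finset.Ico 2 (T + 1), v t ≤ V)
    (hκg : ∀ t ∈ Finset.Ico 2 (T + 1), κ * v t ≤ g) :
    regret μ b a T ω ≤ 1 + √(8 * g ^ 2 * T + 8 * V ^ 2 * (c * T + L)) *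
      √(4 / q * (4 * (d * Real.log T) + L / g ^ 2) + 8 * (d * Real.log T)) := by
  have : Nonempty (Fin N) := ⟨a 0 ω⟩
  have hcard : ((Finset.Ico 2 (T + 1)).card : ℝ) ≤ T := by
    rw [Nat.card_Ico]
    exact_mod_cast (by omega)
  have hgap (t : ℕ) (ht : t ∈ Finset.Ico 2 (T + 1)) :=
    gap_le_excess_mul (hω.1 t ht) hB hTS (one_le_two.trans (Finset.mem_Ico.mp ht).1) (hv t ht) hg hκ
      (hκg t ht)
  have hwidth := sum_sq_playedWidth_le (a := a) (ω := ω) hB.norm_context_le hT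
  have hexcess := sum_sq_excess_le_of_mem_good hω hT hc hv hV
  have hexploration :
      2 * (∑ t ∈ Finset.Ico 2 (T + 1), exploration g μ b a t ω) / g ^ 2 ≤
        4 / q * (4 * (d * Real.log T) + L / g ^ 2) :=
    calc _ ≤ 2 * (2 / q * (g ^ 2 * (4 * (d * Real.log T)) + L)) / g ^ 2 := by
          gcongr
          exact (sum_exploration_le_of_mem_good hω hq).trans (by gcongr)
      _ = _ := by
          field_simp
          ring
  refine (regret_le_one_add hB (by omega)).trans <| add_le_add_right
    ((Finset.sum_le_sum hgap).trans <| (sum_mul_le_sqrt_mul_sqrt_of_nonneg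
      fun t _ ↦ (exploration_mem_Icc ω).1).trans ?_) 1
  refine mul_le_mul (Real.sqrt_le_sqrt (add_le_add (by gcongr) ?_))
    (Real.sqrt_le_sqrt (add_le_add hexploration ?_)) (Real.sqrt_nonneg _) (Real.sqrt_nonneg _)
  · linarith
  · linarith

end Good

/-! ### Scales and bounds -/

section Bounds

variable {d N T : ℕ} {R δ x : ℝ}

/-- The common logarithmic factor of `dimBound` and `armBound`. -/
def logFactor (T : ℕ) (δ : ℝ) : ℝ :=
  Real.log T + √(Real.log T * Real.log (1 / δ))

lemma logFactor_nonneg (T : ℕ) (δ : ℝ) : 0 ≤ logFactor T δ :=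
  add_nonneg (Real.log_natCast_nonneg T) (Real.sqrt_nonneg _)

lemma half_le_log (hx : 2 ≤ x) : 1 / 2 ≤ Real.log x :=
  le_trans (by linarith [Real.log_two_gt_d9]) (Real.log_le_log two_pos hx)

lemma log_div_eq_add_log_one_div (hx : x ≠ 0) (hδ : δ ≠ 0) :
    Real.log (x / δ) = Real.log x + Real.log (1 / δ) := by
  rw [div_eq_mul_one_div, Real.log_mul hx (one_div_ne_zero hδ)]

lemma log_le_log_div (hx : 0 < x) (hδ : 0 < δ) (hδ1 : δ < 1) :
    Real.log x ≤ Real.log (x / δ) :=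
  Real.log_le_log hx (le_div_self hx.le hδ hδ1.le)

lemma min_dimBound_armBound (d N T : ℕ) (δ : ℝ) :
    min (dimBound d T δ) (armBound d N T δ) =
      d * √(min (d : ℝ) (Real.log N)) * √T * logFactor T δ := by
  have hpow : (d : ℝ) ^ (3 / 2 : ℝ) = d * √d := by
    rw [Real.sqrt_eq_rpow, ← Real.rpow_one_add' (Nat.cast_nonneg d) (by norm_num)]
    norm_num
  rw [dimBound, armBound, ← logFactor, hpow, Real.sqrt_monotone.map_min,
    Real.sqrt_mul (Nat.cast_nonneg T), mul_min_of_nonneg _ _ (Nat.cast_nonneg d),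
    min_mul_of_nonneg _ _ (Real.sqrt_nonneg _), min_mul_of_nonneg _ _ (logFactor_nonneg T δ),
    mul_assoc (d : ℝ) √(Real.log N), mul_comm √(Real.log N)]

lemma min_dimBound_armBound_nonneg (d N T : ℕ) (δ : ℝ) :
    0 ≤ min (dimBound d T δ) (armBound d N T δ) := by
  rw [min_dimBound_armBound]
  exact mul_nonneg (by positivity) (logFactor_nonneg T δ)

lemma half_le_min_dim_log (hd : 1 ≤ d) (hN : 2 ≤ N) : 1 / 2 ≤ min (d : ℝ) (Real.log N) := by
  have hd' : (1 : ℝ) ≤ d := by exact_mod_cast hd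
  exact le_min (by linarith) (half_le_log (by exact_mod_cast hN))

lemma sqrt_mul_le_two_mul_bound (hd : 1 ≤ d) (hN : 2 ≤ N) (hx : x ≤ logFactor T δ) :
    √T * x ≤ 2 * min (dimBound d T δ) (armBound d N T δ) := by
  have hm : 1 / 2 ≤ √(min (d : ℝ) (Real.log N)) :=
    Real.le_sqrt_of_sq_le (le_trans (by norm_num) (half_le_min_dim_log hd hN))
  have hdm : 1 / 2 ≤ d * √(min (d : ℝ) (Real.log N)) :=
    hm.trans (le_mul_of_one_le_left (Real.sqrt_nonneg _) (by exact_mod_cast hd))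
  have hfactor := logFactor_nonneg T δ
  rw [min_dimBound_armBound]
  calc √T * x ≤ √T * logFactor T δ := by gcongr
    _ = 2 * (1 / 2 * √T * logFactor T δ) := by ring
    _ ≤ _ := by gcongr

lemma one_le_four_mul_bound (hd : 1 ≤ d) (hN : 2 ≤ N) (hT : 2 ≤ T) :
    1 ≤ 4 * min (dimBound d T δ) (armBound d N T δ) := by
  have hT' : (2 : ℝ) ≤ T := by exact_mod_cast hT
  have hsqrt : 1 ≤ √(T : ℝ) := Real.one_le_sqrt.mpr (by linarith)
  linarith [sqrt_mul_le_two_mul_bound hd hN (T := T) (δ := δ)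
    ((half_le_log hT').trans (le_add_of_nonneg_right (Real.sqrt_nonneg _)))]

lemma horizon_le_four_mul_bound (hd : 1 ≤ d) (hN : 2 ≤ N) (hT : 2 ≤ T)
    (hδT : (T : ℝ) ≤ Real.log (1 / δ)) :
    (T : ℝ) ≤ 4 * min (dimBound d T δ) (armBound d N T δ) := by
  have hlog : 1 / 2 ≤ Real.log (T : ℝ) := half_le_log (by exact_mod_cast hT)
  have hsqrt : √(T : ℝ) / 2 ≤ √(Real.log T * Real.log (1 / δ)) := by
    refine Real.le_sqrt_of_sq_le ?_
    rw [div_pow, Real.sq_sqrt (Nat.cast_nonneg T)]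
    nlinarith [Nat.cast_nonneg (α := ℝ) T]
  have hbound := sqrt_mul_le_two_mul_bound hd hN
    (hsqrt.trans (le_add_of_nonneg_left (Real.log_natCast_nonneg T)))
  rw [← mul_div_assoc, Real.mul_self_sqrt (Nat.cast_nonneg T)] at hbound
  linarith

lemma sqrt_log_mul_log_div_le_logFactor (hT : 1 ≤ T) (hδ : 0 < δ) (hδ1 : δ < 1) :
    √(Real.log T * Real.log (T / δ)) ≤ logFactor T δ := by
  have hlog := Real.log_natCast_nonneg T
  rw [log_div_eq_add_log_one_div (by positivity) hδ.ne', mul_add]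
  refine Real.sqrt_le_iff.mpr ⟨logFactor_nonneg T δ, ?_⟩
  have hsq := Real.sq_sqrt (mul_nonneg hlog (Real.log_nonneg (one_le_one_div hδ hδ1.le)))
  rw [logFactor]
  nlinarith [Real.sqrt_nonneg (Real.log T * Real.log (1 / δ))]

lemma scale_mono (hR : 0 ≤ R) (d : ℕ) (hδ : 0 < δ) {y : ℝ} (hx : 0 < x) (hxy : x ≤ y) :
    scale R d δ x ≤ scale R d δ y := by
  unfold scale
  gcongr

lemma sq_scale (hx : 1 ≤ x) (hδ : 0 < δ) (hδ1 : δ < 1) :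
    scale R d δ x ^ 2 = 9 * R ^ 2 * d * Real.log (x / δ) := by
  have hlog : 0 ≤ Real.log (x / δ) :=
    (Real.log_nonneg hx).trans (log_le_log_div (by linarith) hδ hδ1)
  rw [scale, mul_pow, Real.sq_sqrt (by positivity)]
  ring

lemma two_mul_le_scale (hR : 0 ≤ R) (hd : 1 ≤ d) (hδ : 0 < δ) (hδ1 : δ < 1) (hx : 2 ≤ x) :
    2 * R ≤ scale R d δ x := by
  have hd' : (1 : ℝ) ≤ d := by exact_mod_cast hd
  have hlog : 1 / 2 ≤ Real.log (x / δ) :=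
    (half_le_log hx).trans (log_le_log_div (by linarith) hδ hδ1)
  rw [scale, mul_comm]
  exact mul_le_mul_of_nonneg_left (Real.le_sqrt_of_sq_le (by nlinarith)) hR

lemma scale_pos (hR : 0 < R) (hd : 1 ≤ d) (hδ : 0 < δ) (hδ1 : δ < 1) (hx : 2 ≤ x) :
    0 < scale R d δ x :=
  (mul_pos two_pos hR).trans_le (two_mul_le_scale hR.le hd hδ hδ1 hx)

lemma sqrt_le_scale (hR : 0 ≤ R) (hd : 1 ≤ d) (hδ : 0 < δ) (hδ1 : δ < 1) (hx : 2 ≤ x) {y : ℝ}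
    (hy : y ≤ R ^ 2 * (d * Real.log x + 2 * Real.log (1 / (δ / (3 * x ^ 2))))) :
    √y ≤ scale R d δ x := by
  have hd' : (1 : ℝ) ≤ d := by exact_mod_cast hd
  have hpos : 0 < x := by linarith
  have hlog := log_le_log_div hpos hδ hδ1
  have hlevel : Real.log (1 / (δ / (3 * x ^ 2))) ≤ 4 * Real.log (x / δ) := by
    have hthree : Real.log 3 ≤ 2 * Real.log x := log_le_two_mul_log (by norm_num) (by nlinarith)
    rw [one_div_div, log_div_eq_add_log_one_div (by positivity) hδ.ne',
      Real.log_mul (by norm_num) (by positivity), Real.log_pow,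
      log_div_eq_add_log_one_div hpos.ne' hδ.ne']
    push_cast
    linarith [Real.log_nonneg (one_le_one_div hδ hδ1.le)]
  have hfactor : d * Real.log x + 2 * Real.log (1 / (δ / (3 * x ^ 2))) ≤
      9 * d * Real.log (x / δ) := by
    nlinarith [half_le_log hx]
  calc √y ≤ √(R ^ 2 * (9 * d * Real.log (x / δ))) := Real.sqrt_le_sqrt (hy.trans (by gcongr))
    _ = scale R d δ x := by rw [Real.sqrt_mul (sq_nonneg R), Real.sqrt_sq hR, scale]

lemma log_three_div_le_two_mul_log_div (hδ : 0 < δ) (hδ1 : δ < 1) (hx : 2 ≤ x) :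
    Real.log (3 / δ) ≤ 2 * Real.log (x / δ) := by
  refine log_le_two_mul_log (by positivity) ?_
  rw [div_pow]
  exact div_le_div₀ (sq_nonneg x) (by nlinarith) (by positivity) (by nlinarith)

lemma log_three_div_le_four_mul (hδ : 0 < δ) (hT : 2 ≤ T) (hδT : Real.log (1 / δ) ≤ T) {m : ℝ}
    (hm : 1 / 2 ≤ m) : Real.log (3 / δ) ≤ 4 * m * T := by
  have hT' : (2 : ℝ) ≤ T := by exact_mod_cast hT
  rw [log_div_eq_add_log_one_div (by norm_num) hδ.ne']
  nlinarith [Real.log_le_sub_one_of_pos (by norm_num : (0 : ℝ) < 3)]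

lemma log_three_div_div_sq_le (hR : R ≠ 0) (hd : 1 ≤ d) (hδ : 0 < δ) (hδ1 : δ < 1) (hx : 2 ≤ x)
    {M : ℝ} (hM : 2 ≤ M) :
    Real.log (3 / δ) / (M * scale R d δ x ^ 2) ≤ 2 / R ^ 2 * (d * Real.log x) := by
  have hd' : (1 : ℝ) ≤ d := by exact_mod_cast hd
  have hlog := half_le_log hx
  have hlog' := hlog.trans (log_le_log_div (by linarith) hδ hδ1)
  have hdlog : 1 / 2 ≤ d * Real.log x := hlog.trans (le_mul_of_one_le_left (by linarith) hd')
  rw [sq_scale (by linarith) hδ hδ1, div_le_iff₀ (by positivity)]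
  calc Real.log (3 / δ) ≤ 2 * Real.log (x / δ) := log_three_div_le_two_mul_log_div hδ hδ1 hx
    _ ≤ 18 * (1 / 2) * (2 * 1) * Real.log (x / δ) := by linarith
    _ ≤ 18 * (d * Real.log x) * (M * d) * Real.log (x / δ) := by gcongr
    _ = _ := by
      field_simp
      ring

lemma sqrt_mul_sqrt_le_bound (hR : 0 ≤ R) (hT : 2 ≤ T) (hδ : 0 < δ) (hδ1 : δ < 1) {A B : ℝ}
    (hA : 0 ≤ A) (hB : 0 ≤ B) :
    √(A * (min (d : ℝ) (Real.log N) * scale R d δ T ^ 2 * T)) * √(B * (d * Real.log T)) ≤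
      3 * R * √(A * B) * min (dimBound d T δ) (armBound d N T δ) := by
  have hT' : (1 : ℝ) ≤ T := by exact_mod_cast one_le_two.trans hT
  have hm : 0 ≤ min (d : ℝ) (Real.log N) := le_min d.cast_nonneg (Real.log_natCast_nonneg N)
  calc _ = √((A * B) * ((3 * R * d) ^ 2 *
        (min (d : ℝ) (Real.log N) * (T * (Real.log T * Real.log (T / δ)))))) := by
        rw [← Real.sqrt_mul (by positivity), sq_scale hT' hδ hδ1]
        congr 1
        ring
    _ = 3 * R * √(A * B) * (d * √(min (d : ℝ) (Real.log N)) * √T *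
        √(Real.log T * Real.log (T / δ))) := by
        rw [Real.sqrt_mul (mul_nonneg hA hB), Real.sqrt_mul (sq_nonneg _),
          Real.sqrt_sq (by positivity), Real.sqrt_mul hm, Real.sqrt_mul T.cast_nonneg]
        ring
    _ ≤ _ := by
        rw [min_dimBound_armBound]
        gcongr
        exact sqrt_log_mul_log_div_le_logFactor (one_le_two.trans hT) hδ hδ1

lemma one_add_sqrt_mul_sqrt_le (hR : 0 < R) (hd : 1 ≤ d) (hN : 2 ≤ N) (hT : 2 ≤ T) (hδ : 0 < δ)
    (hδ1 : δ < 1) (hδT : Real.log (1 / δ) ≤ T) {K q g : ℝ} (hK : 2 ≤ K) (hq : 0 < q)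
    (hg : g = K * √(min (d : ℝ) (Real.log N)) * scale R d δ T) :
    1 + √(8 * g ^ 2 * T + 8 * scale R d δ T ^ 2 *
        (3 / 2 * min (d : ℝ) (Real.log N) * T + Real.log (3 / δ))) *
      √(4 / q * (4 * (d * Real.log T) + Real.log (3 / δ) / g ^ 2) + 8 * (d * Real.log T)) ≤
      (4 + 3 * R * √((8 * K ^ 2 + 44) * (4 / q * (4 + 2 / R ^ 2) + 8))) *
        min (dimBound d T δ) (armBound d N T δ) := by
  have hT' : (2 : ℝ) ≤ T := by exact_mod_cast hT
  have hm := half_le_min_dim_log hd hN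
  have hone := one_le_four_mul_bound (δ := δ) hd hN hT
  have hproduct := sqrt_mul_sqrt_le_bound (d := d) (N := N) hR.le hT hδ hδ1
    (by positivity : 0 ≤ 8 * K ^ 2 + 44) (by positivity : 0 ≤ 4 / q * (4 + 2 / R ^ 2) + 8)
  set m := min (d : ℝ) (Real.log N)
  have hg2 : g ^ 2 = K ^ 2 * m * scale R d δ T ^ 2 := by
    rw [hg, mul_pow, mul_pow, Real.sq_sqrt (by linarith)]
  have hratio : Real.log (3 / δ) / g ^ 2 ≤ 2 / R ^ 2 * (d * Real.log T) :=
    hg2 ▸ log_three_div_div_sq_le hR.ne' hd hδ hδ1 hT' (by nlinarith)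
  have hfirst : 8 * g ^ 2 * T + 8 * scale R d δ T ^ 2 * (3 / 2 * m * T + Real.log (3 / δ)) ≤
      (8 * K ^ 2 + 44) * (m * scale R d δ T ^ 2 * T) := by
    rw [hg2]
    linarith [mul_le_mul_of_nonneg_left (log_three_div_le_four_mul hδ hT hδT hm)
      (sq_nonneg (scale R d δ T))]
  have hsecond : 4 / q * (4 * (d * Real.log T) + Real.log (3 / δ) / g ^ 2) +
      8 * (d * Real.log T) ≤ (4 / q * (4 + 2 / R ^ 2) + 8) * (d * Real.log T) := by
    linarith [mul_le_mul_of_nonneg_left hratio (by positivity : 0 ≤ 4 / q)]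
  rw [add_mul]
  exact add_le_add hone (hproduct.trans' (by gcongr))

end Bounds

/-! ### The probability of the good event -/

section Probability

lemma sum_one_div_sq_le (T : ℕ) : ∑ t ∈ Finset.Ico 2 (T + 1), 1 / (t : ℝ) ^ 2 ≤ 1 := by
  rcases Nat.eq_zero_or_pos T with rfl | hT
  · simp
  have htelescope : ∑ t ∈ Finset.Ico 2 (T + 1), 1 / (t : ℝ) ^ 2 ≤ 1 - 1 / (T : ℝ) := by
    induction T, hT using Nat.le_induction with
    | base => simp
    | succ T hT ih =>
      have hT' : (0 : ℝ) < T := by exact_mod_cast hT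
      have hterm : 1 / ((T + 1 : ℕ) : ℝ) ^ 2 ≤ 1 / (T : ℝ) - 1 / ((T + 1 : ℕ) : ℝ) := by
        push_cast
        rw [div_sub_div _ _ (by positivity) (by positivity),
          div_le_div_iff₀ (by positivity) (by positivity)]
        nlinarith
      rw [Finset.sum_Ico_succ_top (by omega)]
      linarith
  exact htelescope.trans (sub_le_self _ (by positivity))

lemma mul_le_of_sqrt_add_mul_le {M κ x g : ℝ} (hx : 0 ≤ x) (h : (√M + κ) * x ≤ g) : κ * x ≤ g :=
  (mul_le_mul_of_nonneg_right (le_add_of_nonneg_left (Real.sqrt_nonneg M)) hx).trans h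

lemma one_sub_le_measureReal {Ω : Type*} [MeasurableSpace Ω] {P : Measure Ω}
    [IsProbabilityMeasure P] {S : Set Ω} {δ : ℝ} (hδ : 0 ≤ δ) (hS : P Sᶜ ≤ ENNReal.ofReal δ) :
    1 - δ ≤ P.real S := by
  have hunion := measureReal_union_le (μ := P) S Sᶜ
  rw [Set.union_compl_self, probReal_univ] at hunion
  linarith [ENNReal.toReal_le_of_le_ofReal hδ hS, measureReal_def P Sᶜ]

/-- The factor `κ` for which `κ v_t` dominates the radius of the confidence ellipsoid: the scale
dominates its noise part, and the bias `1` is at most `v_t / (2 R)`. -/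
def confidenceFactor (R : ℝ) : ℝ := 1 + 1 / (2 * R)

variable {R g q δ M : ℝ}

lemma confidenceFactor_nonneg (hR : 0 ≤ R) : 0 ≤ confidenceFactor R := by
  unfold confidenceFactor
  positivity

variable {Ω : Type*} {d N T : ℕ} {μ : Vec d} {v : ℕ → ℝ} {b : ℕ → Fin N → Ω → Vec d}
  {r : ℕ → Fin N → Ω → ℝ} {a : ℕ → Ω → Fin N} {s : ℕ → Ω → Vec d}

lemma mem_confident_of_selfNormSq_le (hR : 0 < R) (hd : 1 ≤ d) (hδ : 0 < δ) (hδ1 : δ < 1) {t : ℕ}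
    (ht : 2 ≤ t) (hv : scale R d δ t ≤ v t) {ω : Ω}
    (hω : selfNormSq μ b r a t ω ≤
      R ^ 2 * (d * Real.log t + 2 * Real.log (1 / (δ / (3 * (t : ℝ) ^ 2))))) :
    ω ∈ confident (confidenceFactor R) v μ b r a t := by
  have ht' : (2 : ℝ) ≤ t := by exact_mod_cast ht
  have hnoise : √(selfNormSq μ b r a t ω) ≤ v t := (sqrt_le_scale hR.le hd hδ hδ1 ht' hω).trans hv
  have hbias : 1 ≤ 1 / (2 * R) * v t := by
    rw [one_div_mul_eq_div, one_le_div (by positivity)]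
    exact (two_mul_le_scale hR.le hd hδ hδ1 ht').trans hv
  rw [confident, Set.mem_ofPred_eq, confidenceFactor, add_mul, one_mul]
  exact add_le_add hnoise hbias

variable [MeasurableSpace Ω] {P : Measure Ω} [IsProbabilityMeasure P]
  (hB : IsLinearBandit P R μ b r a) (hT : IsThompsonSampling P v b r a s) (hδ : 0 < δ)
include hB hT hδ

lemma measure_exists_lt_selfNormSq_le (hR : R ≠ 0) (T : ℕ) :
    P {ω | ∃ t ∈ Finset.Ico 2 (T + 1), R ^ 2 * (d * Real.log t +
      2 * Real.log (1 / (δ / (3 * (t : ℝ) ^ 2)))) < selfNormSq μ b r a t ω} ≤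
      ENNReal.ofReal (δ / 3) := by
  have hround (t : ℕ) (ht : t ∈ Finset.Ico 2 (T + 1)) : P {ω | R ^ 2 * (d * Real.log t +
      2 * Real.log (1 / (δ / (3 * (t : ℝ) ^ 2)))) < selfNormSq μ b r a t ω} ≤
      ENNReal.ofReal (δ / (3 * (t : ℝ) ^ 2)) := by
    have ht1 : 1 ≤ t := one_le_two.trans (Finset.mem_Ico.mp ht).1
    exact measure_lt_selfNormSq_le hR hB hT ht1 (by positivity)
  have hterm (t : ℕ) : δ / (3 * (t : ℝ) ^ 2) = δ / 3 * (1 / (t : ℝ) ^ 2) := by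
    rw [div_mul_div_comm, mul_one]
  simp only [← exists_prop, Set.ofPred_exists]
  calc _ ≤ ∑ t ∈ Finset.Ico 2 (T + 1), ENNReal.ofReal (δ / (3 * (t : ℝ) ^ 2)) :=
        (measure_biUnion_finset_le _ _).trans (Finset.sum_le_sum hround)
    _ = ENNReal.ofReal (δ / 3 * ∑ t ∈ Finset.Ico 2 (T + 1), 1 / (t : ℝ) ^ 2) := by
        rw [← ENNReal.ofReal_sum_of_nonneg fun t _ ↦ by positivity, Finset.mul_sum]
        simp only [hterm]
    _ ≤ ENNReal.ofReal (δ / 3) :=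
        ENNReal.ofReal_le_ofReal (mul_le_of_le_one_right (by positivity) (sum_one_div_sq_le T))

lemma one_sub_le_measureReal_good (hR : 0 < R) (hd : 1 ≤ d) (hN : 2 ≤ N) (hδ1 : δ < 1)
    (hv : ∀ t ∈ Finset.Ico 2 (T + 1), scale R d δ t ≤ v t) (hg : 0 < g)
    (hMg : ∀ t ∈ Finset.Ico 2 (T + 1), (√M + confidenceFactor R) * v t ≤ g)
    (hM : Real.exp (3 / 2 * min (d : ℝ) (Real.log N) - M / 4) ≤ q)
    (hq : 2 * q ≤ (gaussianReal 0 1).real (Set.Ici (confidenceFactor R))) :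
    1 - δ ≤ P.real (good (confidenceFactor R) g (3 / 2 * min (d : ℝ) (Real.log N)) q
      (Real.log (3 / δ)) v μ b r a T) := by
  have hκ := confidenceFactor_nonneg hR.le
  have htwo {t : ℕ} (ht : t ∈ Finset.Ico 2 (T + 1)) : 2 ≤ t := (Finset.mem_Ico.mp ht).1
  have hone {t : ℕ} (ht : t ∈ Finset.Ico 2 (T + 1)) : 1 ≤ t := one_le_two.trans (htwo ht)
  have hvpos (t : ℕ) (ht : t ∈ Finset.Ico 2 (T + 1)) : 0 < v t :=
    (scale_pos hR hd hδ hδ1 (by exact_mod_cast htwo ht)).trans_le (hv t ht)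
  have hnoise := measure_exists_lt_selfNormSq_le hB hT hδ hR.ne' T
  have hexcess := measure_log_inv_lt_sum_info_le hB one_le_two (T := T + 1)
    (fun t ht ↦ measurable_excessIncrement (hone ht) _)
    (fun t ht ↦ condMeanLEOne_exp_excessIncrement hB hT (hone ht) (hvpos t ht) hN hg hκ
      (mul_le_of_sqrt_add_mul_le (hvpos t ht).le (hMg t ht))) (by positivity : 0 < δ / 3)
  have hexploration := measure_log_inv_lt_sum_info_le hB one_le_two (T := T + 1)
    (fun t ht ↦ measurable_explorationIncrement (hone ht))
    (fun t ht ↦ condMeanLEOne_exp_explorationIncrement hB hT (hone ht) (hvpos t ht) hN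
      (hMg t ht) hM hq) (by positivity : 0 < δ / 3)
  rw [one_div_div] at hexcess hexploration
  refine one_sub_le_measureReal hδ.le ((measure_mono fun ω hω ↦ ?_).trans
    ((measure_union_le _ _).trans ((add_le_add hnoise ((measure_union_le _ _).trans
      (add_le_add hexcess hexploration))).trans_eq ?_)))
  · by_contra hgood
    simp only [Set.mem_union, Set.mem_ofPred_eq, not_or, not_exists, not_and, not_lt] at hgood
    exact hω ⟨fun t ht ↦ mem_confident_of_selfNormSq_le hR hd hδ hδ1 (htwo ht) (hv t ht)
      (hgood.1 t ht), hgood.2⟩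
  · rw [← ENNReal.ofReal_add (by positivity) (by positivity),
      ← ENNReal.ofReal_add (by positivity) (by positivity), ← add_assoc, add_thirds]

end Probability

/-! ### The regret bound -/

section RegretBound

variable {R m : ℝ}

/-- A lower bound for the conditional probability that a sample is optimistic but does not deviate
too much: the second requirement costs at most half of the Gaussian tail. -/
def optimismProb (R : ℝ) : ℝ :=
  (gaussianReal 0 1).real (Set.Ici (confidenceFactor R)) / 2

/-- The factor of `min d (log N)` in the squared deviation beyond which a sample is discarded; its
logarithmic term makes larger deviations less likely than `optimismProb R`. -/
def truncationFactor (R : ℝ) : ℝ :=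
  6 + 8 * Real.log (1 / optimismProb R)

/-- The factor of `√(min d (log N))` and the scale in the radius `g`, which separates saturated
from unsaturated arms. -/
def radiusFactor (R : ℝ) : ℝ :=
  √(truncationFactor R) + 2 * confidenceFactor R

/-- The constant of the regret bound. -/
def regretConst (R : ℝ) : ℝ :=
  4 + 3 * R * √((8 * radiusFactor R ^ 2 + 44) * (4 / optimismProb R * (4 + 2 / R ^ 2) + 8))

lemma optimismProb_pos (R : ℝ) : 0 < optimismProb R :=
  half_pos (gaussianReal_Ici_pos _)

lemma log_one_div_optimismProb_nonneg (R : ℝ) : 0 ≤ Real.log (1 / optimismProb R) := by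
  have hle : optimismProb R ≤ 1 := (half_le_self measureReal_nonneg).trans measureReal_le_one
  exact Real.log_nonneg (one_le_one_div (optimismProb_pos R) hle)

lemma truncationFactor_nonneg (R : ℝ) : 0 ≤ truncationFactor R := by
  rw [truncationFactor]
  linarith [log_one_div_optimismProb_nonneg R]

lemma two_le_radiusFactor (hR : 0 ≤ R) : 2 ≤ radiusFactor R := by
  have hone : 1 ≤ confidenceFactor R := le_add_of_nonneg_right (by positivity)
  rw [radiusFactor]
  linarith [Real.sqrt_nonneg (truncationFactor R)]

lemma four_le_regretConst (hR : 0 ≤ R) : 4 ≤ regretConst R :=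
  le_add_of_nonneg_right (by positivity)

lemma exp_sub_truncationFactor_le (hm : 1 / 2 ≤ m) :
    Real.exp (3 / 2 * m - truncationFactor R * m / 4) ≤ optimismProb R := by
  rw [← Real.le_log_iff_exp_le (optimismProb_pos R), truncationFactor]
  have hlog : Real.log (1 / optimismProb R) = -Real.log (optimismProb R) := by
    rw [one_div, Real.log_inv]
  nlinarith [log_one_div_optimismProb_nonneg R]

lemma sqrt_truncationFactor_mul_add_le (hR : 0 ≤ R) (hm : 1 / 2 ≤ m) :
    √(truncationFactor R * m) + confidenceFactor R ≤ radiusFactor R * √m := by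
  have hsqrt : 1 / 2 ≤ √m := Real.le_sqrt_of_sq_le (by linarith)
  rw [Real.sqrt_mul (truncationFactor_nonneg R), radiusFactor, add_mul]
  nlinarith [confidenceFactor_nonneg hR]

variable {Ω : Type*} {d N T : ℕ} {δ : ℝ} {v : ℕ → ℝ}
  {μ : Vec d} {b : ℕ → Fin N → Ω → Vec d} {r : ℕ → Fin N → Ω → ℝ} {a : ℕ → Ω → Fin N}
  {s : ℕ → Ω → Vec d}

lemma mem_Icc_scale (hR : 0 ≤ R) (hδ : 0 < δ)
    (hv : (∀ t, 1 ≤ t → v t = scale R d δ t) ∨ ∀ t, 1 ≤ t → v t = scale R d δ T) :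
    ∀ t ∈ Finset.Ico 2 (T + 1), v t ∈ Set.Icc (scale R d δ t) (scale R d δ T) := by
  intro t ht
  obtain ⟨htwo, htT⟩ := Finset.mem_Ico.mp ht
  have hmono : scale R d δ t ≤ scale R d δ T :=
    scale_mono hR d hδ (by positivity) (by exact_mod_cast Nat.lt_succ_iff.mp htT)
  rcases hv with hv | hv <;> rw [hv t (one_le_two.trans htwo)]
  · exact ⟨le_rfl, hmono⟩
  · exact ⟨hmono, le_rfl⟩

lemma regret_eq_zero_of_forall_inner_eq (h : ∀ t i j ω, inner ℝ (b t i ω) μ = inner ℝ (b t j ω) μ)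
    (ω : Ω) : regret μ b a T ω = 0 := by
  refine Finset.sum_eq_zero fun t _ ↦ ?_
  have : Nonempty (Fin N) := ⟨a t ω⟩
  rw [gap, funext fun j ↦ h t j (a t ω) ω, ciSup_const, sub_self]

variable [MeasurableSpace Ω] {P : Measure Ω} (hB : IsLinearBandit P R μ b r a)
include hB

lemma regret_le_horizon (T : ℕ) (ω : Ω) : regret μ b a T ω ≤ T := by
  simpa [regret] using Finset.sum_le_card_nsmul (Finset.Icc 1 T) (fun t ↦ gap μ b t (a t ω) ω) 1
    fun t ht ↦ hB.gap_le t (Finset.mem_Icc.mp ht).1 _ ω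

lemma regret_le_of_degenerate (hR : 0 ≤ R) (hT : 2 ≤ T)
    (h : d = 0 ∨ N < 2 ∨ T ≤ Real.log (1 / δ)) (ω : Ω) :
    regret μ b a T ω ≤ regretConst R * min (dimBound d T δ) (armBound d N T δ) := by
  have hbound := min_dimBound_armBound_nonneg d N T δ
  have hconst := four_le_regretConst hR
  rcases Nat.eq_zero_or_pos d with rfl | hd
  · rw [regret_eq_zero_of_forall_inner_eq fun t i j ω ↦ by simp [Subsingleton.elim μ 0]]
    positivity
  rcases Nat.lt_or_ge N 2 with hN | hN
  · have : Subsingleton (Fin N) := Fin.subsingleton_iff_le_one.mpr (by omega)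
    rw [regret_eq_zero_of_forall_inner_eq fun t i j ω ↦ by rw [Subsingleton.elim i j]]
    positivity
  · have hδT : T ≤ Real.log (1 / δ) := (h.resolve_left hd.ne').resolve_left hN.not_gt
    exact (regret_le_horizon hB T ω).trans ((horizon_le_four_mul_bound hd hN hT hδT).trans
      (by gcongr))

lemma one_sub_le_measureReal_regret_le [IsProbabilityMeasure P]
    (hTS : IsThompsonSampling P v b r a s) (hR : 0 < R) (hd : 1 ≤ d) (hN : 2 ≤ N) (hT : 2 ≤ T)
    (hδ : 0 < δ) (hδ1 : δ < 1) (hδT : Real.log (1 / δ) ≤ T)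
    (hv : ∀ t ∈ Finset.Ico 2 (T + 1), v t ∈ Set.Icc (scale R d δ t) (scale R d δ T)) :
    1 - δ ≤ P.real {ω | regret μ b a T ω ≤
      regretConst R * min (dimBound d T δ) (armBound d N T δ)} := by
  have hm := half_le_min_dim_log hd hN
  have hκ := confidenceFactor_nonneg hR.le
  have hK := two_le_radiusFactor hR.le
  have hV : 0 < scale R d δ T := scale_pos hR hd hδ hδ1 (by exact_mod_cast hT)
  have hvpos (t : ℕ) (ht : t ∈ Finset.Ico 2 (T + 1)) : 0 < v t :=
    (scale_pos hR hd hδ hδ1 (by exact_mod_cast (Finset.mem_Ico.mp ht).1)).trans_le (hv t ht).1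
  set m := min (d : ℝ) (Real.log N)
  let g := radiusFactor R * √m * scale R d δ T
  have hg : 0 < g := by positivity
  have hMg (t : ℕ) (ht : t ∈ Finset.Ico 2 (T + 1)) :
      (√(truncationFactor R * m) + confidenceFactor R) * v t ≤ g :=
    mul_le_mul (sqrt_truncationFactor_mul_add_le hR.le hm) (hv t ht).2 (hvpos t ht).le
      (by positivity)
  refine (one_sub_le_measureReal_good hB hTS hδ hR hd hN hδ1 (fun t ht ↦ (hv t ht).1) hg hMg
    (exp_sub_truncationFactor_le hm) (mul_div_cancel₀ _ two_ne_zero).le).trans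
    (measureReal_mono fun ω hω ↦ ?_)
  exact (regret_le_of_mem_good hω hB hTS hT hg hκ (by positivity) (optimismProb_pos R) hvpos
    (fun t ht ↦ (hv t ht).2)
    fun t ht ↦ mul_le_of_sqrt_add_mul_le (hvpos t ht).le (hMg t ht)).trans
    (one_add_sqrt_mul_sqrt_le hR hd hN hT hδ hδ1 hδT hK (optimismProb_pos R) rfl)

end RegretBound

end LinBandit

end

open LinBandit in
theorem theorem1_general {R : ℝ} (hR : 0 < R) {d N T : ℕ} (hT : 2 ≤ T) {δ : ℝ} (hδ : 0 < δ)
    (hδ1 : δ < 1) {v : ℕ → ℝ}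
    (hv : ∀ t ∈ Finset.Ico 2 (T + 1), v t ∈ Set.Icc (scale R d δ t) (scale R d δ T))
    {Ω : Type*} [MeasurableSpace Ω] {P : Measure Ω} [IsProbabilityMeasure P] {μ : Vec d}
    {b : ℕ → Fin N → Ω → Vec d} {r : ℕ → Fin N → Ω → ℝ} {a : ℕ → Ω → Fin N}
    {s : ℕ → Ω → Vec d} (hB : IsLinearBandit P R μ b r a)
    (hTS : IsThompsonSampling P v b r a s) :
    1 - δ ≤ P.real {ω | regret μ b a T ω ≤
      regretConst R * min (dimBound d T δ) (armBound d N T δ)} := by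
  by_cases hdegenerate : d = 0 ∨ N < 2 ∨ T ≤ Real.log (1 / δ)
  · simpa only [regret_le_of_degenerate hB hR.le hT hdegenerate, Set.ofPred_true, probReal_univ]
      using sub_le_self 1 hδ.le
  · simp only [not_or, not_lt, not_le, ← Nat.pos_iff_ne_zero] at hdegenerate
    exact one_sub_le_measureReal_regret_le hB hTS hR hdegenerate.1 hdegenerate.2.1 hT hδ hδ1
      hdegenerate.2.2.le hv

theorem theorem1 (R : ℝ) (hR : 0 < R) :
    ∃ C : ℝ, 0 < C ∧
      ∀ (d N T : ℕ) (_ : 2 ≤ T) (δ : ℝ) (_ : 0 < δ) (_ : δ < 1)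
        (v : ℕ → ℝ)
        (_ : (∀ t : ℕ, 1 ≤ t → v t = LinBandit.scale R d δ t) ∨
          (∀ t : ℕ, 1 ≤ t → v t = LinBandit.scale R d δ T))
        (Ω : Type*) [MeasurableSpace Ω] (P : Measure Ω) [IsProbabilityMeasure P]
        (μ : LinBandit.Vec d) (b : ℕ → Fin N → Ω → LinBandit.Vec d)
        (r : ℕ → Fin N → Ω → ℝ) (a : ℕ → Ω → Fin N) (s : ℕ → Ω → LinBandit.Vec d)
        (_ : LinBandit.IsLinearBandit P R μ b r a)
        (_ : LinBandit.IsThompsonSampling P v b r a s),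
        1 - δ ≤ P.real {ω | LinBandit.regret μ b a T ω ≤
          C * min (LinBandit.dimBound d T δ) (LinBandit.armBound d N T δ)} := by
  refine ⟨LinBandit.regretConst R, by linarith [LinBandit.four_le_regretConst hR.le], ?_⟩
  intro d N T hT δ hδ hδ1 v hv Ω _ P _ μ b r a s hB hTS
  exact theorem1_general hR hT hδ hδ1 (LinBandit.mem_Icc_scale hR.le hδ hv) hB hTS
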